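/- Let $\Bbbk$ be an algebraically closed field of characteristic zero. Let $\mathcal D=(G,\chi,g,\mu)$ be a group datum of non-nilpotent type: $G$ is a finite group, $\chi\colon G\to\Bbbk^\times$ a linear character, $g$ a central element of $G$, and $\mu\in\Bbbk$, such that $\mu(g^n-1)\neq 0$ in $\Bbbk G$ and $\chi^n=1$, where $n$ is the order of $\chi(g)$; assume $n\ge 2$. Let $H$ be the Hopf algebra generated by the group algebra $\Bbbk G$ and an element $y$ with relations $$y^n=\mu(g^n-1),\qquad yh=\chi(h)hy\quad(h\in G),$$ and with $\Delta(y)=y\otimes g+1\otimes y$, $\varepsilon(y)=0$, $S(y)=-yg^{-1}$, $\Delta(h)=h\otimes h$, $\varepsilon(h)=1$, $S(h)=h^{-1}$ for $h\in G$. Let $N=\langle g^n\rangle$, $\overline G=G/N$, let $\overline\chi$ be the character of $\overline G$ induced by $\chi$ and $\overline g$ the image of $g$, and let $\overline H$ be the Hopf algebra attached in the same way to the group datum $(\overline G,\overline\chi,\overline g,0)$, with generator $z$ in place of $y$. All modules are finite dimensional left modules. The Green ring $r(A)$ of a Hopf algebra $A$ is generated as an abelian group by the isomorphism classes $[M]$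 of $A$-modules, with relations $[M\oplus M']=[M]+[M']$ and multiplication $[M][M']=[M\otimes M']$. Restriction along the Hopf algebra epimorphism $H\to\overline H$, $y\mapsto z$, $h\mapsto\overline h$, gives a ring homomorphism $r(\overline H)\to r(H)$, through which $r(\overline H)$ acts on $r(H)$. Let $\{V_i\mid i\in\Omega_0\}$ be a complete set of representatives of the simple $\Bbbk G$-modules on which $g^n$ acts as the identity. For $i\in\Omega_0$ let $M(n,i)=V_i\oplus xV_i\oplus\cdots\oplus x^{n-1}V_i$ be the module on which $h\in G$ acts by $h(x^kv)=\chi^{-k}(h)x^k(hv)$ and $y$ acts by $y(x^kv)=x^{k+1}v$ for $k\le n-2$ and $y(x^{n-1}v)=0$; it is both an $H$-module and an $\overline H$-module. Write $M[n,i]$ for its class in $r(H)$ or in $r(\overline H)$. Let $\mathcal P$ be the two-sided ideal of $r(H)$ generated by the classes of the indecomposable projective $H$-modules. Then $\mathcal P$ is the $\mathbb Z$-span of these classes, and it contains $M[n,i]$ for all $i\in\Omega_0$. Give the abelian group $r(\overline H)\oplus\mathcal P$ the ring structure $$(b_1,c_1)(b_2,c_2)=(b_1b_2,\;b_1c_2+c_1b_2+c_1c_2).$$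 Let $\mathcal I$ be the $\mathbb Z$-submodule of $r(\overline H)\oplus\mathcal P$ generated by the elements $(-M[n,i],M[n,i])$, $i\in\Omega_0$. Then $\mathcal I$ is a two-sided ideal of $r(\overline H)\oplus\mathcal P$, and the quotient ring $(r(\overline H)\oplus\mathcal P)/\mathcal I$ is isomorphic to $r(H)$. -/

import Mathlib

universe u v w

open scoped TensorProduct

/-! ### Finite dimensional modules over a `k`-algebra and the Green ring -/

section Modules

variable (k : Type u) [Field k]

/-- A finite dimensional left module over the `k`-algebra `A`: a finite dimensional vector space
with an algebra homomorphism from `A` to its endomorphism algebra. -/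
structure FDMod (A : Type v) [Ring A] [Algebra k A] where
  carrier : Type u
  [addCommGroup : AddCommGroup carrier]
  [module : Module k carrier]
  [finite : FiniteDimensional k carrier]
  act : A →ₐ[k] Module.End k carrier

namespace FDMod

attribute [instance] FDMod.addCommGroup FDMod.module FDMod.finite

variable {k}

section Ring

variable {A : Type v} [Ring A] [Algebra k A]

/-- Isomorphism of `A`-modules. -/
def Iso (M N : FDMod k A) : Prop :=
  ∃ e : M.carrier ≃ₗ[k] N.carrier, ∀ (a : A) (m : M.carrier), e (M.act a m) = N.act a (e m)

/-- The direct sum of two `A`-modules. -/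
noncomputable def sum (M N : FDMod k A) : FDMod k A where
  carrier := M.carrier × N.carrier
  act := (LinearMap.prodMapAlgHom k M.carrier N.carrier).comp (M.act.prod N.act)

/-- Restriction of the action along an algebra homomorphism. -/
def restrict {B : Type w} [Ring B] [Algebra k B] (f : A →ₐ[k] B) (M : FDMod k B) :
    FDMod k A where
  carrier := M.carrier
  act := M.act.comp f

/-- The carrier of `M`, as a module over the ring `A` in the sense of Mathlib. -/
def asModule (M : FDMod k A) : Type u := M.carrier

instance (M : FDMod k A) : AddCommGroup M.asModule := inferInstanceAs (AddCommGroup M.carrier)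

instance (M : FDMod k A) : Module A M.asModule :=
  Module.compHom M.carrier (M.act : A →+* Module.End k M.carrier)

/-- `M` is projective as an `A`-module. -/
def IsProjective (M : FDMod k A) : Prop := Module.Projective A M.asModule

/-- `M` is nonzero and is not the direct sum of two nonzero modules. -/
def IsIndecomposable (M : FDMod k A) : Prop :=
  Nontrivial M.carrier ∧
    ∀ X Y : FDMod k A, Iso M (X.sum Y) → Subsingleton X.carrier ∨ Subsingleton Y.carrier

theorem Iso.refl (M : FDMod k A) : Iso M M := ⟨LinearEquiv.refl k _, fun _ _ => rfl⟩

theorem Iso.symm {M N : FDMod k A} : Iso M N → Iso N M := by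
  rintro ⟨e, he⟩
  exact ⟨e.symm, fun a m => by rw [LinearEquiv.symm_apply_eq, he, LinearEquiv.apply_symm_apply]⟩

theorem Iso.trans {M N P : FDMod k A} : Iso M N → Iso N P → Iso M P := by
  rintro ⟨e, he⟩ ⟨f, hf⟩
  exact ⟨e.trans f, fun a m => by simp [he, hf]⟩

instance isoSetoid (k : Type u) [Field k] (A : Type v) [Ring A] [Algebra k A] :
    Setoid (FDMod k A) :=
  ⟨Iso, Iso.refl, Iso.symm, Iso.trans⟩

end Ring

section Bialgebra

variable {A : Type v} [Ring A] [Bialgebra k A]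

section Unbundled

variable {V V' W W' X : Type*} [AddCommGroup V] [Module k V] [AddCommGroup V'] [Module k V']
  [AddCommGroup W] [Module k W] [AddCommGroup W'] [Module k W'] [AddCommGroup X] [Module k X]

/-- The action on a tensor product over `k` through the comultiplication. -/
noncomputable def tensorAct (ρ : A →ₐ[k] Module.End k V) (σ : A →ₐ[k] Module.End k W) :
    A →ₐ[k] Module.End k (V ⊗[k] W) :=
  ((Module.endTensorEndAlgHom (R := k) (S := k) (A := k)).comp
    (Algebra.TensorProduct.map ρ σ)).comp (Bialgebra.comulAlgHom k A)

variable (k A) in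
/-- The action on `k` through the counit. -/
noncomputable def trivAct : A →ₐ[k] Module.End k k :=
  (Algebra.lmul k k).comp (Bialgebra.counitAlgHom k A)

theorem tensorAct_repr (ρ : A →ₐ[k] Module.End k V) (σ : A →ₐ[k] Module.End k W)
    {a : A} {ι : Type*} (r : Coalgebra.Repr k a ι) (x : V) (y : W) :
    tensorAct ρ σ a (x ⊗ₜ[k] y) = ∑ i ∈ r.index, ρ (r.left i) x ⊗ₜ[k] σ (r.right i) y := by
  change (Module.endTensorEndAlgHom (R := k) (S := k) (A := k)
    (Algebra.TensorProduct.map ρ σ (Coalgebra.comul a))) (x ⊗ₜ[k] y) = _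
  rw [← r.eq]
  simp only [map_sum, Algebra.TensorProduct.map_tmul, LinearMap.sum_apply]
  rfl

theorem tensorAct_congr {ρ : A →ₐ[k] Module.End k V} {ρ' : A →ₐ[k] Module.End k V'}
    {σ : A →ₐ[k] Module.End k W} {σ' : A →ₐ[k] Module.End k W'}
    (e : V ≃ₗ[k] V') (f : W ≃ₗ[k] W') (he : ∀ a x, e (ρ a x) = ρ' a (e x))
    (hf : ∀ a x, f (σ a x) = σ' a (f x)) (a : A) (t : V ⊗[k] W) :
    TensorProduct.congr e f (tensorAct ρ σ a t) =
      tensorAct ρ' σ' a (TensorProduct.congr e f t) := by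
  induction t with
  | zero => simp
  | add x y hx hy => simp only [map_add, hx, hy]
  | tmul x y =>
    rw [TensorProduct.congr_tmul, tensorAct_repr _ _ (Coalgebra.Repr.arbitrary k a),
      tensorAct_repr _ _ (Coalgebra.Repr.arbitrary k a), map_sum]
    simp only [TensorProduct.congr_tmul, he, hf]

theorem tensorAct_assoc (ρ : A →ₐ[k] Module.End k V) (σ : A →ₐ[k] Module.End k W)
    (θ : A →ₐ[k] Module.End k X) (a : A) (t : (V ⊗[k] W) ⊗[k] X) :
    TensorProduct.assoc k V W X (tensorAct (tensorAct ρ σ) θ a t) =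
      tensorAct ρ (tensorAct σ θ) a (TensorProduct.assoc k V W X t) := by
  let Φ : A ⊗[k] (A ⊗[k] A) →ₐ[k] Module.End k (V ⊗[k] (W ⊗[k] X)) :=
    (Module.endTensorEndAlgHom (R := k) (S := k) (A := k)).comp
      (Algebra.TensorProduct.map ρ
        ((Module.endTensorEndAlgHom (R := k) (S := k) (A := k)).comp
          (Algebra.TensorProduct.map σ θ)))
  have hΦ : ∀ (x y z : A) (m : V) (n : W) (p : X),
      Φ (x ⊗ₜ (y ⊗ₜ z)) (m ⊗ₜ (n ⊗ₜ p)) = ρ x m ⊗ₜ (σ y n ⊗ₜ θ z p) :=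
    fun _ _ _ _ _ _ => rfl
  have key := Coalgebra.coassoc_apply (R := k) a
  suffices h : (TensorProduct.assoc k V W X).toLinearMap ∘ₗ tensorAct (tensorAct ρ σ) θ a =
      tensorAct ρ (tensorAct σ θ) a ∘ₗ (TensorProduct.assoc k V W X).toLinearMap from
    LinearMap.congr_fun h t
  refine TensorProduct.ext_threefold fun m n p => ?_
  have r := Coalgebra.Repr.arbitrary k a
  have lhs : (TensorProduct.assoc k V W X)
      (tensorAct (tensorAct ρ σ) θ a ((m ⊗ₜ[k] n) ⊗ₜ[k] p)) =
      Φ (TensorProduct.assoc k A A A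
        ((Coalgebra.comul (R := k)).rTensor A (Coalgebra.comul (R := k) a)))
        (m ⊗ₜ (n ⊗ₜ p)) := by
    rw [tensorAct_repr _ _ r]
    conv_rhs => rw [← r.eq]
    simp only [map_sum, LinearMap.sum_apply, LinearMap.rTensor_tmul]
    refine Finset.sum_congr rfl fun i _ => ?_
    have s := Coalgebra.Repr.arbitrary k (r.left i)
    rw [tensorAct_repr _ _ s, ← s.eq]
    simp only [TensorProduct.sum_tmul, map_sum, LinearMap.sum_apply,
      TensorProduct.assoc_tmul, hΦ]
  have rhs : tensorAct ρ (tensorAct σ θ) a (m ⊗ₜ[k] (n ⊗ₜ[k] p)) =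
      Φ ((Coalgebra.comul (R := k)).lTensor A (Coalgebra.comul (R := k) a))
        (m ⊗ₜ (n ⊗ₜ p)) := by
    rw [tensorAct_repr _ _ r]
    conv_rhs => rw [← r.eq]
    simp only [map_sum, LinearMap.sum_apply, LinearMap.lTensor_tmul]
    refine Finset.sum_congr rfl fun i _ => ?_
    have s := Coalgebra.Repr.arbitrary k (r.right i)
    rw [tensorAct_repr _ _ s, ← s.eq]
    simp only [TensorProduct.tmul_sum, map_sum, LinearMap.sum_apply, hΦ]
  refine lhs.trans (Eq.trans ?_ rhs.symm)
  rw [key]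

theorem trivAct_tensorAct (ρ : A →ₐ[k] Module.End k V) (a : A) (t : k ⊗[k] V) :
    TensorProduct.lid k V (tensorAct (trivAct k A) ρ a t) = ρ a (TensorProduct.lid k V t) := by
  induction t with
  | zero => simp
  | add x y hx hy => simp only [map_add, hx, hy]
  | tmul c m =>
    have r := Coalgebra.Repr.arbitrary k a
    have h : ∀ i, TensorProduct.lid k V (trivAct k A (r.left i) c ⊗ₜ[k] ρ (r.right i) m) =
        ρ (Coalgebra.counit (R := k) (r.left i) • r.right i) (c • m) := by
      intro i
      rw [map_smul ρ, LinearMap.smul_apply, map_smul (ρ _), smul_smul]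
      rfl
    rw [tensorAct_repr _ _ r, map_sum, Finset.sum_congr rfl fun i _ => h i,
      ← LinearMap.sum_apply, ← map_sum, Coalgebra.sum_counit_smul r, TensorProduct.lid_tmul]

theorem tensorAct_trivAct (ρ : A →ₐ[k] Module.End k V) (a : A) (t : V ⊗[k] k) :
    TensorProduct.rid k V (tensorAct ρ (trivAct k A) a t) = ρ a (TensorProduct.rid k V t) := by
  induction t with
  | zero => simp
  | add x y hx hy => simp only [map_add, hx, hy]
  | tmul m c =>
    have r := Coalgebra.Repr.arbitrary k a
    have h : ∀ i, TensorProduct.rid k V (ρ (r.left i) m ⊗ₜ[k] trivAct k A (r.right i) c) =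
        ρ (Coalgebra.counit (R := k) (r.right i) • r.left i) (c • m) := by
      intro i
      rw [map_smul ρ, LinearMap.smul_apply, map_smul (ρ _), smul_smul]
      rfl
    have h' : ∑ i ∈ r.index, Coalgebra.counit (R := k) (r.right i) • r.left i = a := by
      have h1 := Coalgebra.lTensor_counit_comul (R := k) a
      rw [← r.eq, map_sum] at h1
      have h2 := congrArg (TensorProduct.rid k A) h1
      rw [map_sum, TensorProduct.rid_tmul, one_smul] at h2
      exact h2
    rw [tensorAct_repr _ _ r, map_sum, Finset.sum_congr rfl fun i _ => h i,
      ← LinearMap.sum_apply, ← map_sum, h', TensorProduct.rid_tmul]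

theorem tensorAct_comp {B : Type*} [Ring B] [Bialgebra k B] (f : A →ₐc[k] B)
    (ρ : B →ₐ[k] Module.End k V) (σ : B →ₐ[k] Module.End k W) (a : A) :
    tensorAct ρ σ (f a) =
      tensorAct (ρ.comp (f : A →ₐ[k] B)) (σ.comp (f : A →ₐ[k] B)) a := by
  have h : Coalgebra.comul (R := k) (f a) =
      Algebra.TensorProduct.map (f : A →ₐ[k] B) (f : A →ₐ[k] B) (Coalgebra.comul (R := k) a) :=
    (CoalgHomClass.map_comp_comul_apply f a).symm
  change Module.endTensorEndAlgHom (R := k) (S := k) (A := k)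
    (Algebra.TensorProduct.map ρ σ (Coalgebra.comul (f a))) =
    Module.endTensorEndAlgHom (R := k) (S := k) (A := k)
    (Algebra.TensorProduct.map (ρ.comp (f : A →ₐ[k] B)) (σ.comp (f : A →ₐ[k] B))
      (Coalgebra.comul a))
  rw [h, Algebra.TensorProduct.map_comp]
  rfl

theorem trivAct_comp {B : Type*} [Ring B] [Bialgebra k B] (f : A →ₐc[k] B) (a : A) :
    trivAct k B (f a) = trivAct k A a := by
  change Algebra.lmul k k (Coalgebra.counit (R := k) (f a)) =
    Algebra.lmul k k (Coalgebra.counit (R := k) a)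
  rw [CoalgHomClass.counit_comp_apply]

end Unbundled

/-- The tensor product over `k`, with `A` acting through the comultiplication. -/
noncomputable def tensor (M N : FDMod k A) : FDMod k A where
  carrier := M.carrier ⊗[k] N.carrier
  act := tensorAct M.act N.act

/-- The trivial module `k`, with `A` acting through the counit. -/
noncomputable def triv (k : Type u) [Field k] (A : Type v) [Ring A] [Bialgebra k A] :
    FDMod k A where
  carrier := k
  act := trivAct k A

theorem tensor_congr {M M' N N' : FDMod k A} :
    Iso M M' → Iso N N' → Iso (tensor M N) (tensor M' N') :=
  fun ⟨e, he⟩ ⟨f, hf⟩ => ⟨TensorProduct.congr e f, tensorAct_congr e f he hf⟩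

theorem tensor_assoc (M N P : FDMod k A) :
    Iso (tensor (tensor M N) P) (tensor M (tensor N P)) :=
  ⟨TensorProduct.assoc k M.carrier N.carrier P.carrier, tensorAct_assoc M.act N.act P.act⟩

theorem triv_tensor (M : FDMod k A) : Iso (tensor (triv k A) M) M :=
  ⟨TensorProduct.lid k M.carrier, trivAct_tensorAct M.act⟩

theorem tensor_triv (M : FDMod k A) : Iso (tensor M (triv k A)) M :=
  ⟨TensorProduct.rid k M.carrier, tensorAct_trivAct M.act⟩

theorem restrict_tensor {B : Type w} [Ring B] [Bialgebra k B] (f : A →ₐc[k] B)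
    (M N : FDMod k B) :
    Iso (restrict (f : A →ₐ[k] B) (tensor M N))
      (tensor (restrict (f : A →ₐ[k] B) M) (restrict (f : A →ₐ[k] B) N)) :=
  ⟨LinearEquiv.refl k _, fun a t => LinearMap.congr_fun (tensorAct_comp f M.act N.act a) t⟩

theorem restrict_triv {B : Type w} [Ring B] [Bialgebra k B] (f : A →ₐc[k] B) :
    Iso (restrict (f : A →ₐ[k] B) (triv k B)) (triv k A) :=
  ⟨LinearEquiv.refl k _, fun a t => LinearMap.congr_fun (trivAct_comp f a) t⟩

end Bialgebra

end FDMod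

section GreenRing

variable (A : Type v) [Ring A] [Bialgebra k A]

/-- Isomorphism classes of finite dimensional `A`-modules. -/
def FDModClass : Type (max (u + 1) v) := Quotient (FDMod.isoSetoid k A)

/-- Isomorphism classes form a monoid under the tensor product. -/
noncomputable instance FDModClass.instMonoid : Monoid (FDModClass k A) where
  mul := Quotient.map₂ FDMod.tensor fun _ _ h _ _ h' => FDMod.tensor_congr h h'
  one := Quotient.mk _ (FDMod.triv k A)
  mul_assoc := by
    rintro ⟨M⟩ ⟨N⟩ ⟨P⟩
    exact Quotient.sound (FDMod.tensor_assoc M N P)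
  one_mul := by
    rintro ⟨M⟩
    exact Quotient.sound (FDMod.triv_tensor M)
  mul_one := by
    rintro ⟨M⟩
    exact Quotient.sound (FDMod.tensor_triv M)

/-- The free abelian group on the isomorphism classes, a ring under the tensor product. -/
abbrev FreeGreen : Type (max (u + 1) v) := FreeAbelianGroup (FDModClass k A)

variable {k A} in
/-- The class of `M` in the free abelian group on the isomorphism classes. -/
def FreeGreen.of (M : FDMod k A) : FreeGreen k A := FreeAbelianGroup.of (Quotient.mk _ M : FDModClass k A)

/-- The relations `[M ⊕ N] = [M] + [N]`. -/
inductive GreenRel : FreeGreen k A → FreeGreen k A → Prop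
  | sum (M N : FDMod k A) :
      GreenRel (FreeGreen.of (M.sum N)) (FreeGreen.of M + FreeGreen.of N)

/-- The Green ring `r(A)`. -/
def GreenRing : Type (max (u + 1) v) := RingQuot (GreenRel k A)

noncomputable instance GreenRing.instRing : Ring (GreenRing k A) :=
  inferInstanceAs (Ring (RingQuot (GreenRel k A)))

variable {k A}

/-- The class `[M]` in the Green ring. -/
noncomputable def GreenRing.cls (M : FDMod k A) : GreenRing k A :=
  RingQuot.mkRingHom (GreenRel k A) (FreeGreen.of M)

theorem GreenRing.cls_congr {M N : FDMod k A} (h : M.Iso N) :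
    GreenRing.cls M = GreenRing.cls N :=
  congrArg (fun c => RingQuot.mkRingHom (GreenRel k A) (FreeAbelianGroup.of c)) (Quotient.sound h)

theorem GreenRing.cls_sum (M N : FDMod k A) :
    GreenRing.cls (M.sum N) = GreenRing.cls M + GreenRing.cls N :=
  (RingQuot.mkRingHom_rel (GreenRel.sum M N)).trans (map_add _ _ _)

theorem GreenRing.cls_tensor (M N : FDMod k A) :
    GreenRing.cls (M.tensor N) = GreenRing.cls M * GreenRing.cls N := by
  refine Eq.trans ?_ (map_mul (RingQuot.mkRingHom (GreenRel k A)) _ _)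
  refine congrArg (RingQuot.mkRingHom (GreenRel k A)) ?_
  exact (FreeAbelianGroup.of_mul_of (α := FDModClass k A) (Quotient.mk _ M) (Quotient.mk _ N)).symm

theorem GreenRing.cls_triv : GreenRing.cls (FDMod.triv k A) = 1 :=
  map_one (RingQuot.mkRingHom (GreenRel k A))

/-- Restriction of modules along a bialgebra homomorphism, as a ring homomorphism of Green
rings, `[M] ↦ [M]`. -/
noncomputable def GreenRing.restrict {B : Type w} [Ring B] [Bialgebra k B] (f : A →ₐc[k] B) :
    GreenRing k B →+* GreenRing k A :=
  RingQuot.lift ⟨FreeAbelianGroup.liftMonoid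
    { toFun := Quotient.lift (fun M => GreenRing.cls (M.restrict (f : A →ₐ[k] B))) (by
        rintro M N ⟨e, he⟩
        exact GreenRing.cls_congr ⟨e, fun a m => he (f a) m⟩)
      map_one' := (GreenRing.cls_congr (FDMod.restrict_triv f)).trans GreenRing.cls_triv
      map_mul' := by
        rintro ⟨M⟩ ⟨N⟩
        exact (GreenRing.cls_congr (FDMod.restrict_tensor f M N)).trans
          (GreenRing.cls_tensor _ _) }, by
    rintro _ _ ⟨M, N⟩
    rw [map_add]
    simp only [FreeGreen.of, FreeAbelianGroup.liftMonoid_coe]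
    erw [FreeAbelianGroup.lift_apply_of, FreeAbelianGroup.lift_apply_of,
      FreeAbelianGroup.lift_apply_of]
    exact GreenRing.cls_sum (M.restrict (f : A →ₐ[k] B)) (N.restrict (f : A →ₐ[k] B))⟩

theorem GreenRing.restrict_cls {B : Type w} [Ring B] [Bialgebra k B] (f : A →ₐc[k] B)
    (M : FDMod k B) :
    GreenRing.restrict f (GreenRing.cls M) = GreenRing.cls (M.restrict (f : A →ₐ[k] B)) := by
  unfold GreenRing.restrict GreenRing.cls
  erw [RingQuot.lift_mkRingHom_apply]
  simp only [FreeGreen.of, FreeAbelianGroup.liftMonoid_coe]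
  erw [FreeAbelianGroup.lift_apply_of]
  rfl

variable (k A)

/-- The classes of the finite dimensional indecomposable projective `A`-modules. -/
def GreenRing.projIndec : Set (GreenRing k A) :=
  {x | ∃ M : FDMod k A, M.IsIndecomposable ∧ M.IsProjective ∧ x = GreenRing.cls M}

/-- The two-sided ideal of the Green ring generated by the classes of the finite dimensional
indecomposable projective modules. -/
noncomputable def GreenRing.projIdeal : TwoSidedIdeal (GreenRing k A) :=
  TwoSidedIdeal.span (GreenRing.projIndec k A)

end GreenRing

end Modules

/-! ### The multiplication on `R ⊕ P` -/

/-- For a ring homomorphism `f : R → S` and a two-sided ideal `P` of `S`, the abelian group `R ⊕ P`,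
which is given a multiplication below. -/
@[ext]
structure TrivialExt {R : Type u} {S : Type v} [Ring R] [Ring S] (_f : R →+* S)
    (P : TwoSidedIdeal S) where
  fst : R
  snd : P

namespace TrivialExt

variable {R : Type u} {S : Type v} [Ring R] [Ring S] {f : R →+* S} {P : TwoSidedIdeal S}

instance : Add (TrivialExt f P) := ⟨fun x y => ⟨x.fst + y.fst, x.snd + y.snd⟩⟩
instance : Zero (TrivialExt f P) := ⟨⟨0, 0⟩⟩
instance : Neg (TrivialExt f P) := ⟨fun x => ⟨-x.fst, -x.snd⟩⟩
instance : Sub (TrivialExt f P) := ⟨fun x y => ⟨x.fst - y.fst, x.snd - y.snd⟩⟩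
instance : SMul ℕ (TrivialExt f P) := ⟨fun m x => ⟨m • x.fst, m • x.snd⟩⟩
instance : SMul ℤ (TrivialExt f P) := ⟨fun m x => ⟨m • x.fst, m • x.snd⟩⟩
instance : One (TrivialExt f P) := ⟨⟨1, 0⟩⟩

/-- `(b₁, c₁) (b₂, c₂) = (b₁ b₂, b₁ c₂ + c₁ b₂ + c₁ c₂)`, with `R` acting on `P` through `f`. -/
instance : Mul (TrivialExt f P) :=
  ⟨fun x y => ⟨x.fst * y.fst, ⟨f x.fst * y.snd + x.snd * f y.fst + x.snd * y.snd,
    P.add_mem (P.add_mem (P.mul_mem_left _ _ y.snd.2) (P.mul_mem_right _ _ x.snd.2))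
      (P.mul_mem_left _ _ y.snd.2)⟩⟩⟩

instance : AddCommGroup (TrivialExt f P) :=
  Function.Injective.addCommGroup (fun x : TrivialExt f P => (x.fst, x.snd))
    (fun _ _ h => TrivialExt.ext (congrArg Prod.fst h) (congrArg Prod.snd h))
    rfl (fun _ _ => rfl) (fun _ => rfl) (fun _ _ => rfl) (fun _ _ => rfl) (fun _ _ => rfl)

theorem fst_add (x y : TrivialExt f P) : (x + y).fst = x.fst + y.fst := rfl
theorem snd_add (x y : TrivialExt f P) : ((x + y).snd : S) = x.snd + y.snd := rfl
theorem fst_zero : (0 : TrivialExt f P).fst = 0 := rfl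
theorem snd_zero : ((0 : TrivialExt f P).snd : S) = 0 := rfl
theorem fst_one : (1 : TrivialExt f P).fst = 1 := rfl
theorem snd_one : ((1 : TrivialExt f P).snd : S) = 0 := rfl
theorem fst_mul (x y : TrivialExt f P) : (x * y).fst = x.fst * y.fst := rfl
theorem snd_mul (x y : TrivialExt f P) :
    ((x * y).snd : S) = f x.fst * y.snd + x.snd * f y.fst + x.snd * y.snd := rfl

theorem ext' {x y : TrivialExt f P} (h : x.fst = y.fst) (h' : (x.snd : S) = y.snd) : x = y :=
  TrivialExt.ext h (Subtype.ext h')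

instance : Ring (TrivialExt f P) :=
  { (inferInstance : AddCommGroup (TrivialExt f P)) with
    mul_assoc := fun x y z => ext' (mul_assoc _ _ _) (by
      simp only [snd_mul, fst_mul, map_mul]; noncomm_ring)
    one_mul := fun x => ext' (one_mul _) (by simp [snd_mul, fst_one, snd_one])
    mul_one := fun x => ext' (mul_one _) (by simp [snd_mul, fst_one, snd_one])
    zero_mul := fun x => ext' (zero_mul _) (by simp [snd_mul, fst_zero, snd_zero])
    mul_zero := fun x => ext' (mul_zero _) (by simp [snd_mul, fst_zero, snd_zero])
    left_distrib := fun x y z => ext' (mul_add _ _ _) (by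
      simp only [snd_mul, snd_add, fst_add, map_add]; noncomm_ring)
    right_distrib := fun x y z => ext' (add_mul _ _ _) (by
      simp only [snd_mul, snd_add, fst_add, map_add]; noncomm_ring) }

end TrivialExt

/-! ### The `q`-binomial formula at a root of unity -/

section QBinomial

variable {k : Type u} [Field k]

/-- The Gaussian binomial coefficient `(i + j choose i)_q`. -/
def qBinom (q : k) : ℕ → ℕ → k
  | 0, _ => 1
  | _ + 1, 0 => 1
  | i + 1, j + 1 => qBinom q i (j + 1) + q ^ (i + 1) * qBinom q (i + 1) j

theorem qBinom_zero_right (q : k) (i : ℕ) : qBinom q i 0 = 1 := by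
  cases i <;> simp [qBinom]

theorem qBinom_zero_left (q : k) (j : ℕ) : qBinom q 0 j = 1 := by
  simp [qBinom]

theorem qBinom_mul (q : k) (i j : ℕ) :
    (∏ l ∈ Finset.range i, (q ^ (l + 1) - 1)) * (∏ l ∈ Finset.range j, (q ^ (l + 1) - 1)) *
      qBinom q i j = ∏ l ∈ Finset.range (i + j), (q ^ (l + 1) - 1) := by
  induction i generalizing j with
  | zero => simp [qBinom_zero_left]
  | succ i ih =>
    induction j with
    | zero => simp [qBinom_zero_right]
    | succ j ihj =>
      have h1 := ih (j + 1)
      have e : ∏ l ∈ Finset.range (i + 1 + (j + 1)), (q ^ (l + 1) - 1) =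
          (∏ l ∈ Finset.range (i + 1 + j), (q ^ (l + 1) - 1)) * (q ^ (i + 1 + j + 1) - 1) :=
        Finset.prod_range_succ _ (i + 1 + j)
      rw [show i + (j + 1) = i + 1 + j by ring] at h1
      rw [e, qBinom]
      rw [Finset.prod_range_succ _ j] at h1 ⊢
      rw [Finset.prod_range_succ _ i] at ihj ⊢
      linear_combination (q ^ (i + 1) - 1) * h1 + q ^ (i + 1) * (q ^ (j + 1) - 1) * ihj

theorem qBinom_eq_zero {q : k} {n : ℕ} (hq : IsPrimitiveRoot q n) {i j : ℕ} (h : i + j = n)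
    (hi : i ≠ 0) (hj : j ≠ 0) : qBinom q i j = 0 := by
  have h1 := qBinom_mul q i j
  have h0 : ∏ l ∈ Finset.range (i + j), (q ^ (l + 1) - 1) = 0 :=
    Finset.prod_eq_zero (i := n - 1) (by simp; omega)
      (by rw [Nat.sub_add_cancel (by omega), hq.pow_eq_one, sub_self])
  have hne : ∀ m < n, ∏ l ∈ Finset.range m, (q ^ (l + 1) - 1) ≠ 0 := fun m hm =>
    Finset.prod_ne_zero_iff.2 fun l hl => sub_ne_zero.2
      (hq.pow_ne_one_of_pos_of_lt (by omega) (by have := Finset.mem_range.1 hl; omega))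
  rw [h0] at h1
  exact (mul_eq_zero.1 h1).resolve_left (mul_ne_zero (hne i (by omega)) (hne j (by omega)))

variable {A : Type v} [Ring A] [Algebra k A]

theorem mul_pow_of_qcomm {q : k} {a b : A} (h : b * a = q • (a * b)) (i : ℕ) :
    b * a ^ i = q ^ i • (a ^ i * b) := by
  induction i with
  | zero => simp
  | succ i ih =>
    rw [pow_succ, ← mul_assoc, ih, smul_mul_assoc, mul_assoc, h, mul_smul_comm, smul_smul,
      pow_succ, mul_assoc]

theorem add_pow_of_qcomm {q : k} {a b : A} (h : b * a = q • (a * b)) (m : ℕ) :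
    (a + b) ^ m = ∑ p ∈ Finset.HasAntidiagonal.antidiagonal m, qBinom q p.1 p.2 • (a ^ p.1 * b ^ p.2) := by
  induction m with
  | zero => simp [qBinom]
  | succ m ih =>
    let X : ℕ × ℕ → A := fun p => match p with
      | (0, _) => 0
      | (i + 1, j) => qBinom q i j • (a ^ (i + 1) * b ^ j)
    let Y : ℕ × ℕ → A := fun p => match p with
      | (_, 0) => 0
      | (i, j + 1) => (q ^ i * qBinom q i j) • (a ^ i * b ^ (j + 1))
    have hXY : ∀ p ∈ Finset.HasAntidiagonal.antidiagonal (m + 1),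
        qBinom q p.1 p.2 • (a ^ p.1 * b ^ p.2) = X p + Y p := by
      rintro ⟨i, j⟩ hp
      rcases i with _ | i <;> rcases j with _ | j
      · simp at hp
      · simp [X, Y, qBinom]
      · simp [X, Y, qBinom_zero_right]
      · simp [X, Y, qBinom, add_smul]
    rw [Finset.sum_congr rfl hXY, Finset.sum_add_distrib, Finset.Nat.sum_antidiagonal_succ,
      Finset.Nat.sum_antidiagonal_succ' (f := Y), pow_succ', ih, add_mul, Finset.mul_sum,
      Finset.mul_sum]
    simp only [X, Y, zero_add]
    congr 1
    · refine Finset.sum_congr rfl fun p _ => ?_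
      rw [mul_smul_comm, ← mul_assoc, ← pow_succ']
    · refine Finset.sum_congr rfl fun p _ => ?_
      rw [mul_smul_comm, ← mul_assoc, mul_pow_of_qcomm h, smul_mul_assoc, smul_smul, mul_assoc,
        ← pow_succ', mul_comm]

theorem add_pow_of_primitive {q : k} {n : ℕ} (hn : n ≠ 0) (hq : IsPrimitiveRoot q n) {a b : A}
    (h : b * a = q • (a * b)) : (a + b) ^ n = a ^ n + b ^ n := by
  rw [add_pow_of_qcomm h, Finset.sum_eq_add (n, 0) (0, n)]
  · simp [qBinom_zero_right, qBinom_zero_left]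
  · simp [hn]
  · rintro ⟨i, j⟩ hp ⟨h1, h2⟩
    rw [Finset.HasAntidiagonal.mem_antidiagonal] at hp
    rw [qBinom_eq_zero hq hp, zero_smul]
    · rintro rfl; apply h2; simp at hp; simp [hp]
    · rintro rfl; apply h1; simp at hp; simp [hp]
  · simp
  · simp

theorem mul_pow_of_qcomm' {q : k} {a b : A} (h : b * a = q • (a * b)) (m : ℕ) :
    (a * b) ^ m = q ^ (∑ i ∈ Finset.range m, i) • (a ^ m * b ^ m) := by
  have h' : ∀ i : ℕ, b ^ i * a = q ^ i • (a * b ^ i) := by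
    intro i
    induction i with
    | zero => simp
    | succ i ih =>
      rw [pow_succ, mul_assoc, h, mul_smul_comm, ← mul_assoc, ih, smul_mul_assoc, smul_smul,
        mul_assoc, pow_succ' q]
  induction m with
  | zero => simp
  | succ m ih =>
    rw [pow_succ, ih, Finset.sum_range_succ, smul_mul_assoc, pow_add, mul_smul]
    congr 1
    rw [pow_succ a, pow_succ b, mul_assoc, ← mul_assoc (b ^ m), h', smul_mul_assoc, mul_smul_comm]
    noncomm_ring

theorem primitive_pow_sum {q : k} {n : ℕ} (hn : n ≠ 0) (hq : IsPrimitiveRoot q n) :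
    (-1) ^ n * q ^ (∑ i ∈ Finset.range n, i) = -1 := by
  have h2 := Finset.sum_range_id_mul_two n
  rcases Nat.even_or_odd' n with ⟨m, rfl | rfl⟩
  · have hm : q ^ m = -1 := by
      have h1 : q ^ m * q ^ m = 1 := by rw [← pow_add, ← two_mul, hq.pow_eq_one]
      refine (mul_self_eq_one_iff.1 h1).resolve_left ?_
      exact hq.pow_ne_one_of_pos_of_lt (by omega) (by omega)
    have hs : ∑ i ∈ Finset.range (2 * m), i = m * (2 * m - 1) := by
      apply Nat.eq_of_mul_eq_mul_right two_pos; rw [h2]; ring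
    rw [hs, pow_mul q, hm, ← pow_add, show 2 * m + (2 * m - 1) = 2 * (2 * m - 1) + 1 by omega,
      pow_succ, pow_mul]
    simp
  · have hs : ∑ i ∈ Finset.range (2 * m + 1), i = (2 * m + 1) * m := by
      apply Nat.eq_of_mul_eq_mul_right two_pos; rw [h2]; simp; ring
    rw [hs, pow_mul q, hq.pow_eq_one, one_pow, mul_one, pow_succ, pow_mul]
    simp

end QBinomial

/-! ### Group data and the associated Hopf algebras -/

/-- A group datum `(G, χ, g, μ)`, with `n` the order of `χ(g)`. -/
structure GroupDatum (k : Type u) [Field k] (G : Type v) [Group G] where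
  χ : G →* kˣ
  g : G
  μ : k
  central : g ∈ Subgroup.center G
  compat : χ ^ orderOf (χ g) = 1 ∨
    μ • (MonoidAlgebra.of k G (g ^ orderOf (χ g)) - 1) = 0

namespace GroupDatum

variable {k : Type u} [Field k] {G : Type v} [Group G]

/-- The order of `q = χ(g)`. -/
noncomputable def n (D : GroupDatum k G) : ℕ := orderOf (D.χ D.g)

/-- The group datum is of non-nilpotent type: `μ (gⁿ - 1) ≠ 0` and `χⁿ = 1`. -/
def NonNilpotent (D : GroupDatum k G) : Prop :=
  D.μ • (MonoidAlgebra.of k G (D.g ^ D.n) - 1) ≠ 0 ∧ D.χ ^ D.n = 1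

theorem commute (D : GroupDatum k G) (h : G) : h * D.g = D.g * h :=
  Subgroup.mem_center_iff.1 D.central h

theorem χ_pow_n (D : GroupDatum k G) : D.χ D.g ^ D.n = 1 := pow_orderOf_eq_one _

theorem χ_g_pow_n (D : GroupDatum k G) : D.χ (D.g ^ D.n) = 1 := by rw [map_pow, D.χ_pow_n]

/-- The generators of the Hopf algebra. -/
inductive Gen (G : Type v) : Type v
  | y : Gen G
  | grp (h : G) : Gen G

/-- The defining relations of the Hopf algebra: those of the group algebra of `G`,
`yⁿ = μ (gⁿ - 1)` and `y h = χ(h) h y`. -/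
inductive Rel (D : GroupDatum k G) : FreeAlgebra k (Gen G) → FreeAlgebra k (Gen G) → Prop
  | one : Rel D (FreeAlgebra.ι k (Gen.grp 1)) 1
  | mul (h h' : G) : Rel D (FreeAlgebra.ι k (Gen.grp (h * h')))
      (FreeAlgebra.ι k (Gen.grp h) * FreeAlgebra.ι k (Gen.grp h'))
  | pow : Rel D (FreeAlgebra.ι k Gen.y ^ D.n)
      (D.μ • (FreeAlgebra.ι k (Gen.grp (D.g ^ D.n)) - 1))
  | comm (h : G) : Rel D (FreeAlgebra.ι k Gen.y * FreeAlgebra.ι k (Gen.grp h))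
      ((D.χ h : k) • (FreeAlgebra.ι k (Gen.grp h) * FreeAlgebra.ι k Gen.y))

/-- The algebra `H_D` associated to the group datum `D`. -/
def H (D : GroupDatum k G) : Type (max u v) := RingQuot (Rel D)

noncomputable instance (D : GroupDatum k G) : Ring D.H :=
  inferInstanceAs (Ring (RingQuot (Rel D)))

noncomputable instance instAlgebra (D : GroupDatum k G) : Algebra k D.H :=
  inferInstanceAs (Algebra k (RingQuot (Rel D)))

variable (D : GroupDatum k G)

/-- The quotient map from the free algebra. -/
noncomputable def quot : FreeAlgebra k (Gen G) →ₐ[k] D.H := RingQuot.mkAlgHom k (Rel D)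

/-- The generator `y`. -/
noncomputable def y : D.H := D.quot (FreeAlgebra.ι k Gen.y)

/-- The inclusion of `G`. -/
noncomputable def gr : G →* D.H where
  toFun h := D.quot (FreeAlgebra.ι k (Gen.grp h))
  map_one' := (RingQuot.mkAlgHom_rel k Rel.one).trans (map_one _)
  map_mul' h h' := (RingQuot.mkAlgHom_rel k (Rel.mul h h')).trans (map_mul _ _ _)

theorem y_pow : D.y ^ D.n = D.μ • (D.gr (D.g ^ D.n) - 1) := by
  have h := RingQuot.mkAlgHom_rel k (Rel.pow (D := D))
  have h2 : D.quot (FreeAlgebra.ι k Gen.y ^ D.n) =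
    D.quot (D.μ • (FreeAlgebra.ι k (Gen.grp (D.g ^ D.n)) - 1)) := h
  rw [map_pow, map_smul, map_sub, map_one] at h2
  exact h2

theorem y_mul (h : G) : D.y * D.gr h = (D.χ h : k) • (D.gr h * D.y) := by
  have h1 := RingQuot.mkAlgHom_rel k (Rel.comm (D := D) h)
  have h2 : D.quot (FreeAlgebra.ι k Gen.y * FreeAlgebra.ι k (Gen.grp h)) =
    D.quot ((D.χ h : k) • (FreeAlgebra.ι k (Gen.grp h) * FreeAlgebra.ι k Gen.y)) := h1
  rw [map_mul, map_smul, map_mul] at h2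
  exact h2

/-- The universal property of `H_D`. -/
noncomputable def lift {A : Type w} [Ring A] [Algebra k A] (φ : G →* A) (Y : A)
    (hpow : Y ^ D.n = D.μ • (φ (D.g ^ D.n) - 1))
    (hcomm : ∀ h, Y * φ h = (D.χ h : k) • (φ h * Y)) : D.H →ₐ[k] A :=
  RingQuot.liftAlgHom k ⟨FreeAlgebra.lift k (fun x => match x with
    | Gen.y => Y
    | Gen.grp h => φ h), by
      intro a b hab
      cases hab with
      | one => simp
      | mul h h' => simp
      | pow => simpa using hpow
      | comm h => simpa using hcomm h⟩

section lift

variable {D} {A : Type w} [Ring A] [Algebra k A] {φ : G →* A} {Y : A}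
  {hpow : Y ^ D.n = D.μ • (φ (D.g ^ D.n) - 1)}
  {hcomm : ∀ h, Y * φ h = (D.χ h : k) • (φ h * Y)}

@[simp]
theorem lift_y : D.lift φ Y hpow hcomm D.y = Y :=
  (RingQuot.liftAlgHom_mkAlgHom_apply k _ _ _).trans (by rw [FreeAlgebra.lift_ι_apply])

@[simp]
theorem lift_gr (h : G) : D.lift φ Y hpow hcomm (D.gr h) = φ h :=
  (RingQuot.liftAlgHom_mkAlgHom_apply k _ _ _).trans (by rw [FreeAlgebra.lift_ι_apply])

end lift

variable {D} in
theorem induction {P : D.H → Prop} (halg : ∀ c : k, P (algebraMap k D.H c)) (hy : P D.y)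
    (hgr : ∀ h, P (D.gr h)) (hmul : ∀ a b, P a → P b → P (a * b))
    (hadd : ∀ a b, P a → P b → P (a + b)) (a : D.H) : P a := by
  obtain ⟨x, rfl⟩ := RingQuot.mkAlgHom_surjective k (Rel D) a
  change P (D.quot x)
  induction x with
  | grade0 c => rw [AlgHom.commutes]; exact halg c
  | grade1 x => cases x with
    | y => exact hy
    | grp h => exact hgr h
  | mul a b ha hb => rw [map_mul]; exact hmul _ _ ha hb
  | add a b ha hb => rw [map_add]; exact hadd _ _ ha hb

variable {D} in
theorem algHom_ext {A : Type w} [Semiring A] [Algebra k A] {f f' : D.H →ₐ[k] A}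
    (hy : f D.y = f' D.y) (hgr : ∀ h, f (D.gr h) = f' (D.gr h)) : f = f' := by
  ext a
  refine induction (P := fun a => f a = f' a) ?_ hy hgr ?_ ?_ a
  · intro c; rw [AlgHom.commutes, AlgHom.commutes]
  · intro a b ha hb; rw [map_mul, map_mul, ha, hb]
  · intro a b ha hb; rw [map_add, map_add, ha, hb]

theorem n_ne_zero [Finite G] : D.n ≠ 0 := 
  ((MonoidHom.isOfFinOrder D.χ (isOfFinOrder_of_finite D.g)).orderOf_pos).ne'

theorem isPrimitiveRoot : IsPrimitiveRoot (D.χ D.g : k) D.n :=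
  IsPrimitiveRoot.coe_units_iff.2 (IsPrimitiveRoot.orderOf _)

/-- The comultiplication: `Δ(h) = h ⊗ h` and `Δ(y) = y ⊗ g + 1 ⊗ y`. -/
noncomputable def comul [Finite G] : D.H →ₐ[k] D.H ⊗[k] D.H :=
  D.lift
    { toFun := fun h => D.gr h ⊗ₜ[k] D.gr h
      map_one' := by rw [map_one]; rfl
      map_mul' := fun h h' => by rw [map_mul, Algebra.TensorProduct.tmul_mul_tmul] }
    (D.y ⊗ₜ[k] D.gr D.g + 1 ⊗ₜ[k] D.y)
    (by
      rw [add_pow_of_primitive D.n_ne_zero D.isPrimitiveRoot, Algebra.TensorProduct.tmul_pow,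
        Algebra.TensorProduct.tmul_pow, y_pow, one_pow, ← map_pow]
      · change _ = D.μ • (D.gr (D.g ^ D.n) ⊗ₜ[k] D.gr (D.g ^ D.n) - 1)
        rw [Algebra.TensorProduct.one_def, TensorProduct.tmul_smul, ← TensorProduct.smul_tmul',
          ← smul_add, TensorProduct.sub_tmul, TensorProduct.tmul_sub]
        congr 1
        abel
      · rw [Algebra.TensorProduct.tmul_mul_tmul, Algebra.TensorProduct.tmul_mul_tmul, one_mul,
          mul_one, y_mul, TensorProduct.tmul_smul])
    (by
      intro h
      change (D.y ⊗ₜ[k] D.gr D.g + 1 ⊗ₜ[k] D.y) * (D.gr h ⊗ₜ[k] D.gr h) =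
        (D.χ h : k) • ((D.gr h ⊗ₜ[k] D.gr h) * (D.y ⊗ₜ[k] D.gr D.g + 1 ⊗ₜ[k] D.y))
      simp only [add_mul, mul_add, Algebra.TensorProduct.tmul_mul_tmul, one_mul, mul_one, smul_add,
        y_mul, TensorProduct.tmul_smul, ← TensorProduct.smul_tmul', ← map_mul, D.commute h])

/-- The counit: `ε(h) = 1` and `ε(y) = 0`. -/
noncomputable def counit [Finite G] : D.H →ₐ[k] k :=
  D.lift 1 0 (by simp [D.n_ne_zero]) (by simp)

theorem y_mul_inv : D.gr D.g⁻¹ * D.y = (D.χ D.g : k) • (D.y * D.gr D.g⁻¹) := by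
  rw [y_mul, smul_smul, ← Units.val_mul, ← map_mul, mul_inv_cancel, map_one, Units.val_one,
    one_smul]

/-- The antipode, as an algebra homomorphism to the opposite algebra: `S(h) = h⁻¹` and
`S(y) = -y g⁻¹`. -/
noncomputable def antipodeOp [Finite G] : D.H →ₐ[k] D.Hᵐᵒᵖ :=
  D.lift
    { toFun := fun h => MulOpposite.op (D.gr h⁻¹)
      map_one' := by simp
      map_mul' := fun h h' => by rw [mul_inv_rev, map_mul, MulOpposite.op_mul] }
    (MulOpposite.op (-(D.y * D.gr D.g⁻¹)))
    (by
      change _ = D.μ • (MulOpposite.op (D.gr (D.g ^ D.n)⁻¹) - 1)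
      rw [← MulOpposite.op_pow, ← MulOpposite.op_one, ← MulOpposite.op_sub, ← MulOpposite.op_smul]
      congr 1
      rw [← neg_one_smul k, smul_pow, mul_pow_of_qcomm' D.y_mul_inv, smul_smul,
        primitive_pow_sum D.n_ne_zero D.isPrimitiveRoot, y_pow, ← map_pow, smul_mul_assoc, sub_mul,
        ← map_mul, inv_pow, mul_inv_cancel, map_one, one_mul, neg_one_smul, ← smul_neg, neg_sub])
    (by
      intro h
      change MulOpposite.op (-(D.y * D.gr D.g⁻¹)) * MulOpposite.op (D.gr h⁻¹) =
        (D.χ h : k) • (MulOpposite.op (D.gr h⁻¹) * MulOpposite.op (-(D.y * D.gr D.g⁻¹)))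
      rw [← MulOpposite.op_mul, ← MulOpposite.op_mul, ← MulOpposite.op_smul]
      congr 1
      have hc : D.g⁻¹ * h⁻¹ = h⁻¹ * D.g⁻¹ := by
        rw [← mul_inv_rev, ← mul_inv_rev, D.commute]
      rw [mul_neg, neg_mul, smul_neg, mul_assoc, ← map_mul, hc, map_mul, ← mul_assoc D.y, D.y_mul h⁻¹,
        smul_mul_assoc, smul_smul, ← Units.val_mul, ← map_mul, mul_inv_cancel, map_one,
        Units.val_one, one_smul, mul_assoc])

noncomputable instance instBialgebra [Finite G] : Bialgebra k D.H :=
  Bialgebra.ofAlgHom D.comul D.counit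
    (algHom_ext (by
        simp [comul, TensorProduct.tmul_add, TensorProduct.add_tmul,
          Algebra.TensorProduct.one_def, add_assoc])
      (fun h => by simp [comul]))
    (algHom_ext (by simp [comul, counit]) (fun h => by simp [comul, counit]))
    (algHom_ext (by simp [comul, counit]) (fun h => by simp [comul, counit]))

theorem comul_y [Finite G] : Coalgebra.comul (R := k) D.y = D.y ⊗ₜ[k] D.gr D.g + 1 ⊗ₜ[k] D.y :=
  lift_y

theorem comul_gr [Finite G] (h : G) : Coalgebra.comul (R := k) (D.gr h) = D.gr h ⊗ₜ[k] D.gr h :=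
  lift_gr h

theorem counit_y [Finite G] : Coalgebra.counit (R := k) D.y = 0 := lift_y

theorem counit_gr [Finite G] (h : G) : Coalgebra.counit (R := k) (D.gr h) = 1 := lift_gr h

/-- The antipode. -/
noncomputable def antipode [Finite G] : D.H →ₗ[k] D.H :=
  (MulOpposite.opLinearEquiv k).symm.toLinearMap ∘ₗ D.antipodeOp.toLinearMap

theorem antipode_mul [Finite G] (a b : D.H) : D.antipode (a * b) = D.antipode b * D.antipode a := by
  simp [antipode]

theorem antipode_algebraMap [Finite G] (c : k) :
    D.antipode (algebraMap k D.H c) = algebraMap k D.H c := by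
  simp [antipode]

theorem antipode_y [Finite G] : D.antipode D.y = -(D.y * D.gr D.g⁻¹) := by
  simp [antipode, antipodeOp]

theorem antipode_gr [Finite G] (h : G) : D.antipode (D.gr h) = D.gr h⁻¹ := by
  simp [antipode, antipodeOp]

theorem antipode_left [Finite G] (a : D.H) :
    LinearMap.mul' k D.H (D.antipode.rTensor D.H (Coalgebra.comul a)) =
      algebraMap k D.H (Coalgebra.counit a) := by
  have h1 : ∀ (x y : D.H) (T : D.H ⊗[k] D.H),
      LinearMap.mul' k D.H (D.antipode.rTensor D.H (T * (x ⊗ₜ y))) =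
        D.antipode x * LinearMap.mul' k D.H (D.antipode.rTensor D.H T) * y := by
    intro x y T
    induction T with
    | zero => simp
    | add a b ha hb => simp only [add_mul, mul_add, map_add, ha, hb]
    | tmul a b => simp [antipode_mul, mul_assoc]
  have h2 : ∀ (c : k) (T U : D.H ⊗[k] D.H),
      LinearMap.mul' k D.H (D.antipode.rTensor D.H T) = algebraMap k D.H c →
      LinearMap.mul' k D.H (D.antipode.rTensor D.H (T * U)) =
        algebraMap k D.H c * LinearMap.mul' k D.H (D.antipode.rTensor D.H U) := by
    intro c T U hT
    induction U with
    | zero => simp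
    | add a b ha hb => simp only [mul_add, map_add, ha, hb]
    | tmul a b =>
      rw [h1, hT, ← Algebra.commutes, mul_assoc]
      simp
  refine induction (P := fun a => LinearMap.mul' k D.H (D.antipode.rTensor D.H
    (Coalgebra.comul a)) = algebraMap k D.H (Coalgebra.counit a)) ?_ ?_ ?_ ?_ ?_ a
  · intro c
    rw [Bialgebra.comul_algebraMap, Bialgebra.counit_algebraMap]
    simp [Algebra.TensorProduct.algebraMap_apply, antipode_algebraMap]
  · have h3 : D.antipode 1 = 1 := by simpa using D.antipode_algebraMap 1
    rw [comul_y, counit_y]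
    simp [antipode_y, h3, mul_assoc, ← map_mul]
  · intro h
    rw [comul_gr, counit_gr]
    simp [antipode_gr, ← map_mul]
  · intro a b ha hb
    rw [Bialgebra.comul_mul, h2 _ _ _ ha, hb, Bialgebra.counit_mul, map_mul]
  · intro a b ha hb
    simp only [map_add, ha, hb]

theorem antipode_right [Finite G] (a : D.H) :
    LinearMap.mul' k D.H (D.antipode.lTensor D.H (Coalgebra.comul a)) =
      algebraMap k D.H (Coalgebra.counit a) := by
  have h1 : ∀ (x y : D.H) (T : D.H ⊗[k] D.H),
      LinearMap.mul' k D.H (D.antipode.lTensor D.H ((x ⊗ₜ y) * T)) =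
        x * LinearMap.mul' k D.H (D.antipode.lTensor D.H T) * D.antipode y := by
    intro x y T
    induction T with
    | zero => simp
    | add a b ha hb => simp only [add_mul, mul_add, map_add, ha, hb]
    | tmul a b => simp [antipode_mul, mul_assoc]
  have h2 : ∀ (c : k) (T U : D.H ⊗[k] D.H),
      LinearMap.mul' k D.H (D.antipode.lTensor D.H U) = algebraMap k D.H c →
      LinearMap.mul' k D.H (D.antipode.lTensor D.H (T * U)) =
        LinearMap.mul' k D.H (D.antipode.lTensor D.H T) * algebraMap k D.H c := by
    intro c T U hU
    induction T with
    | zero => simp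
    | add a b ha hb => simp only [add_mul, map_add, ha, hb]
    | tmul a b =>
      rw [h1, hU, mul_assoc, Algebra.commutes, ← mul_assoc]
      simp
  refine induction (P := fun a => LinearMap.mul' k D.H (D.antipode.lTensor D.H
    (Coalgebra.comul a)) = algebraMap k D.H (Coalgebra.counit a)) ?_ ?_ ?_ ?_ ?_ a
  · intro c
    rw [Bialgebra.comul_algebraMap, Bialgebra.counit_algebraMap]
    have h3 : D.antipode 1 = 1 := by simpa using D.antipode_algebraMap 1
    simp [Algebra.TensorProduct.algebraMap_apply, h3]
  · rw [comul_y, counit_y]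
    simp [antipode_y, antipode_gr]
  · intro h
    rw [comul_gr, counit_gr]
    simp [antipode_gr, ← map_mul]
  · intro a b ha hb
    rw [Bialgebra.comul_mul, h2 _ _ _ hb, ha, Bialgebra.counit_mul, map_mul]
  · intro a b ha hb
    simp only [map_add, ha, hb]

/-- The Hopf algebra structure on `H_D`. -/
noncomputable instance instHopfAlgebra [Finite G] : HopfAlgebra k D.H where
  antipode := D.antipode
  mul_antipode_rTensor_comul := LinearMap.ext D.antipode_left
  mul_antipode_lTensor_comul := LinearMap.ext D.antipode_right

/-! ### The quotient datum -/

theorem pow_mem_center : D.g ^ D.n ∈ Subgroup.center G := Subgroup.pow_mem _ D.central _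

/-- The subgroup `N` of `G` generated by `gⁿ`. -/
noncomputable def N : Subgroup G := Subgroup.zpowers (D.g ^ D.n)

instance : D.N.Normal :=
  ⟨fun x hx h => by
    have hc : x ∈ Subgroup.center G := (Subgroup.zpowers_le.2 D.pow_mem_center) hx
    rwa [Subgroup.mem_center_iff.1 hc h, mul_inv_cancel_right]⟩

theorem map_eq_one {M : Type*} [Monoid M] (φ : G →* M) (h : φ (D.g ^ D.n) = 1) :
    ∀ x ∈ D.N, φ x = 1 := by
  have h1 : D.N ≤ φ.ker := Subgroup.zpowers_le.2 h
  exact fun x hx => h1 hx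

/-- The group datum `(G / N, χ̄, ḡ, 0)`. -/
noncomputable def bar : GroupDatum k (G ⧸ D.N) where
  χ := QuotientGroup.lift D.N D.χ (D.map_eq_one D.χ D.χ_g_pow_n)
  g := QuotientGroup.mk' D.N D.g
  μ := 0
  central := by
    rw [Subgroup.mem_center_iff]
    intro x
    obtain ⟨h, rfl⟩ := QuotientGroup.mk'_surjective D.N x
    rw [← map_mul, D.commute, map_mul]
  compat := Or.inr (zero_smul _ _)

theorem bar_n : D.bar.n = D.n := rfl

theorem bar_g_pow_n : D.bar.g ^ D.bar.n = 1 := by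
  change QuotientGroup.mk' D.N D.g ^ D.n = 1
  rw [← map_pow]
  exact (QuotientGroup.eq_one_iff _).2 (Subgroup.mem_zpowers _)

/-- The map `H → H̄` given by `y ↦ z` and `h ↦ h̄`, as an algebra homomorphism. -/
noncomputable def projAlgHom : D.H →ₐ[k] D.bar.H :=
  D.lift (D.bar.gr.comp (QuotientGroup.mk' D.N)) D.bar.y
    (by
      change D.bar.y ^ D.bar.n = D.μ • (D.bar.gr (QuotientGroup.mk' D.N (D.g ^ D.n)) - 1)
      have h : QuotientGroup.mk' D.N (D.g ^ D.n) = 1 := D.bar_g_pow_n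
      rw [y_pow, h, bar_g_pow_n, map_one, sub_self, smul_zero, smul_zero])
    (fun h => D.bar.y_mul (QuotientGroup.mk' D.N h))

theorem projAlgHom_y : D.projAlgHom D.y = D.bar.y := lift_y

theorem projAlgHom_gr (h : G) :
    D.projAlgHom (D.gr h) = D.bar.gr (QuotientGroup.mk' D.N h) := lift_gr h

/-- The Hopf algebra epimorphism `H → H̄` given by `y ↦ z` and `h ↦ h̄`. -/
noncomputable def proj [Finite G] : D.H →ₐc[k] D.bar.H :=
  BialgHom.ofAlgHom D.projAlgHom
    (algHom_ext (by
        change Coalgebra.counit (R := k) (D.projAlgHom D.y) = Coalgebra.counit (R := k) D.y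
        rw [projAlgHom_y, counit_y, counit_y])
      (fun h => by
        change Coalgebra.counit (R := k) (D.projAlgHom (D.gr h)) =
          Coalgebra.counit (R := k) (D.gr h)
        rw [projAlgHom_gr, counit_gr, counit_gr]))
    (algHom_ext (by
        change Algebra.TensorProduct.map D.projAlgHom D.projAlgHom (Coalgebra.comul (R := k) D.y) =
          Coalgebra.comul (R := k) (D.projAlgHom D.y)
        rw [projAlgHom_y, comul_y, comul_y, map_add, Algebra.TensorProduct.map_tmul,
          Algebra.TensorProduct.map_tmul, projAlgHom_y, projAlgHom_gr, map_one]
        rfl)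
      (fun h => by
        change Algebra.TensorProduct.map D.projAlgHom D.projAlgHom
            (Coalgebra.comul (R := k) (D.gr h)) =
          Coalgebra.comul (R := k) (D.projAlgHom (D.gr h))
        rw [projAlgHom_gr, comul_gr, comul_gr, Algebra.TensorProduct.map_tmul, projAlgHom_gr]))

/-! ### The modules `M(j, i)` -/

section StringModules

variable {V : Type u} [AddCommGroup V] [Module k V]

/-- The action of `G` on `V ⊕ xV ⊕ ⋯ ⊕ x^{j-1}V`, given by `h (xⁱ v) = χ⁻ⁱ(h) xⁱ (h v)`. The element
`f : Fin j → V` stands for `∑ i, xⁱ (f i)`. -/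
noncomputable def stringGrp (ρ : Representation k G V) (j : ℕ) :
    G →* Module.End k (Fin j → V) where
  toFun h := LinearMap.pi fun i =>
    ((((D.χ h)⁻¹ ^ (i : ℕ) : kˣ) : k) • ρ h) ∘ₗ LinearMap.proj i
  map_one' := by ext; simp
  map_mul' h h' := by
    refine LinearMap.ext fun f => funext fun i => ?_
    simp [mul_pow, smul_smul, mul_comm]

variable (k V) in
/-- The shift `xⁱ v ↦ xⁱ⁺¹ v` for `i ≤ j - 2`, and `x^{j-1} v ↦ 0`. -/
def stringShift (j : ℕ) : Module.End k (Fin j → V) where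
  toFun f i := if (i : ℕ) = 0 then 0 else f ⟨i - 1, lt_of_le_of_lt (Nat.sub_le _ _) i.2⟩
  map_add' f f' := by ext i; by_cases h : (i : ℕ) = 0 <;> simp [h]
  map_smul' c f := by ext i; by_cases h : (i : ℕ) = 0 <;> simp [h]

theorem stringShift_pow (j m : ℕ) (f : Fin j → V) (i : Fin j) :
    (stringShift k V j ^ m) f i =
      if (i : ℕ) < m then 0 else f ⟨i - m, lt_of_le_of_lt (Nat.sub_le _ _) i.2⟩ := by
  induction m generalizing i with
  | zero => simp
  | succ m ih =>
    rw [pow_succ', Module.End.mul_apply]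
    change (if (i : ℕ) = 0 then 0 else (stringShift k V j ^ m) f
      ⟨i - 1, lt_of_le_of_lt (Nat.sub_le _ _) i.2⟩) = _
    rw [ih]
    by_cases h0 : (i : ℕ) = 0
    · simp [h0]
    · by_cases h1 : (i : ℕ) - 1 < m
      · rw [if_neg h0, if_pos h1, if_pos (by omega)]
      · rw [if_neg h0, if_neg h1, if_neg (by omega)]
        congr 2
        simp only
        omega

theorem stringShift_pow_eq_zero {j m : ℕ} (h : j ≤ m) : stringShift k V j ^ m = 0 := by
  refine LinearMap.ext fun f => funext fun i => ?_
  rw [stringShift_pow, if_pos (lt_of_lt_of_le i.2 h)]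
  rfl

/-- The action of `H_D` on `V ⊕ xV ⊕ ⋯ ⊕ x^{j-1}V`, for `j ≤ n` and a `kG`-module `V` on which `gⁿ`
acts as the identity. -/
noncomputable def stringAct (ρ : Representation k G V) (hρ : ρ (D.g ^ D.n) = 1) {j : ℕ}
    (hj : j ≤ D.n) : D.H →ₐ[k] Module.End k (Fin j → V) :=
  D.lift (D.stringGrp ρ j) (stringShift k V j)
    (by
      have h1 : D.stringGrp ρ j (D.g ^ D.n) = 1 := by
        refine LinearMap.ext fun f => funext fun i => ?_
        change (((D.χ (D.g ^ D.n))⁻¹ ^ (i : ℕ) : kˣ) : k) • ρ (D.g ^ D.n) (f i) = f i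
        rw [χ_g_pow_n, hρ]
        simp
      rw [stringShift_pow_eq_zero hj, h1, sub_self, smul_zero])
    (by
      intro h
      refine LinearMap.ext fun f => funext fun i => ?_
      change (if (i : ℕ) = 0 then 0 else (((D.χ h)⁻¹ ^ ((i : ℕ) - 1) : kˣ) : k) •
          ρ h (f ⟨i - 1, lt_of_le_of_lt (Nat.sub_le _ _) i.2⟩)) =
        (D.χ h : k) • (((D.χ h)⁻¹ ^ (i : ℕ) : kˣ) : k) •
          ρ h (if (i : ℕ) = 0 then 0 else f ⟨i - 1, lt_of_le_of_lt (Nat.sub_le _ _) i.2⟩)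
      by_cases h0 : (i : ℕ) = 0
      · simp [h0]
      · rw [if_neg h0, if_neg h0, smul_smul, ← Units.val_mul]
        congr 3
        conv_rhs => rw [show (i : ℕ) = (i : ℕ) - 1 + 1 by omega, pow_succ', mul_inv_cancel_left])

variable (ρ : Representation k G V) (hρ : ρ (D.g ^ D.n) = 1) {j : ℕ} (hj : j ≤ D.n)

theorem stringAct_y : D.stringAct ρ hρ hj D.y = stringShift k V j := lift_y

theorem stringAct_gr (h : G) : D.stringAct ρ hρ hj (D.gr h) = D.stringGrp ρ j h := lift_gr h

/-- The `H_D`-module `V ⊕ xV ⊕ ⋯ ⊕ x^{j-1}V`. -/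
noncomputable def stringModule [FiniteDimensional k V] : FDMod k D.H where
  carrier := Fin j → V
  act := D.stringAct ρ hρ hj

end StringModules

/-- The simple `kG`-modules `V` on which `gⁿ` acts as the identity. Their isomorphism classes are
the `V_i` with `i ∈ Ω₀`. -/
structure Omega₀ where
  V : Type u
  [addCommGroup : AddCommGroup V]
  [module : Module k V]
  [finite : FiniteDimensional k V]
  ρ : Representation k G V
  simple : ρ.IsIrreducible
  act_pow : ρ (D.g ^ D.n) = 1

attribute [instance] Omega₀.addCommGroup Omega₀.module Omega₀.finite

variable {D}

/-- The `H`-module `M(j, i)`, for `j ≤ n`. -/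
noncomputable def Omega₀.M (i : D.Omega₀) {j : ℕ} (hj : j ≤ D.n) : FDMod k D.H :=
  D.stringModule i.ρ i.act_pow hj

/-- `V_i` as a module over `k[G / N]`. -/
noncomputable def Omega₀.ρbar (i : D.Omega₀) : Representation k (G ⧸ D.N) i.V :=
  QuotientGroup.lift D.N i.ρ (D.map_eq_one i.ρ i.act_pow)

theorem Omega₀.ρbar_pow (i : D.Omega₀) : i.ρbar (D.bar.g ^ D.bar.n) = 1 := by
  rw [bar_g_pow_n, map_one]

/-- The `H̄`-module `M(j, i)`, for `j ≤ n`. -/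
noncomputable def Omega₀.Mbar (i : D.Omega₀) {j : ℕ} (hj : j ≤ D.n) : FDMod k D.bar.H :=
  D.bar.stringModule i.ρbar i.ρbar_pow (j := j) hj

/-- The `H̄`-module `M(j, i)` regarded as an `H`-module is the `H`-module `M(j, i)`. -/
theorem Omega₀.restrict_Mbar (i : D.Omega₀) {j : ℕ} (hj : j ≤ D.n) :
    ((i.Mbar hj).restrict D.projAlgHom).Iso (i.M hj) := by
  have h : (i.Mbar hj).act.comp D.projAlgHom = (i.M hj).act := by
    refine algHom_ext ?_ ?_
    · rw [AlgHom.comp_apply, projAlgHom_y]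
      exact (D.bar.stringAct_y i.ρbar i.ρbar_pow hj).trans
        (D.stringAct_y i.ρ i.act_pow hj).symm
    · intro h
      rw [AlgHom.comp_apply, projAlgHom_gr]
      exact (D.bar.stringAct_gr i.ρbar i.ρbar_pow hj _).trans
        (D.stringAct_gr i.ρ i.act_pow hj h).symm
  exact ⟨LinearEquiv.refl k _, fun a m => LinearMap.congr_fun (DFunLike.congr_fun h a) m⟩

theorem Omega₀.restrict_cls_Mbar [Finite G] (i : D.Omega₀) {j : ℕ} (hj : j ≤ D.n) :
    GreenRing.restrict D.proj (GreenRing.cls (i.Mbar hj)) = GreenRing.cls (i.M hj) :=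
  (GreenRing.restrict_cls D.proj (i.Mbar hj)).trans (GreenRing.cls_congr (i.restrict_Mbar hj))

end GroupDatum

/-! The element `gⁿ` is central in `H` and has finite order, so every `H`-module `M` is the direct
sum of the vectors fixed by `gⁿ` and the image of `gⁿ - 1` (`iso_fixedSub_sum_movedSub`). The first
summand is an `H̄`-module. On the second, `yⁿ = μ(gⁿ - 1)` is invertible, and this forces
projectivity (`isProjective_movedSub`). Hence `(b, c) ↦ b + c` is a ring homomorphism from `r(H̄) ⊕
P` onto `r(H)`, and the work lies in its kernel.

Taking fixed vectors is additive and gives a group homomorphism `fixedGreen : r(H) → r(H̄)` which is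
a left inverse of restriction. If `b + c = 0` in `r(H)`, applying it shows that `b = -fixedGreen c`
and that `c` is the restriction of `fixedGreen c`. So it suffices to know `fixedGreen` on
indecomposable projectives. Such a module is either moved entirely, with image `0`, or fixed
entirely, and then it is some `M(n, i)` (`exists_iso_M`). Thus the kernel is spanned by the elements
`(-M[n,i], M[n,i])`. Only existence of decompositions into indecomposables is used, not uniqueness.

Projectivity is handled relative to `kG`, which is semisimple by averaging. In the manner of
Higman's criterion, `M` is projective exactly when the identity has the form `∑ yⁱ t yⁿ⁻¹⁻ⁱ` for a
linear map `t` that commutes with `G` up to the character `χⁿ⁻¹` (`hasTrace_of_isProjective`,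
`HasTrace.isProjective`). Projectives are also the direct summands of modules induced from `kG`.
With the tensor identities `induced_tensor_iso` and `tensor_induced_iso`, this shows that their span
is an ideal (`coe_projIdeal`). -/

namespace FDMod

variable {k : Type u} [Field k]

/-! ### Homomorphisms, stable subspaces and direct sums of modules. -/

section Ring

variable {A : Type v} [Ring A] [Algebra k A]

/-- A linear map between the carriers of two modules commutes with the action. -/
def IsHom (M N : FDMod k A) (f : M.carrier →ₗ[k] N.carrier) : Prop :=
  ∀ a m, f (M.act a m) = N.act a (f m)

theorem IsHom.iso {M N : FDMod k A} {f : M.carrier →ₗ[k] N.carrier} (hf : IsHom M N f)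
    (hb : Function.Bijective f) : Iso M N :=
  ⟨LinearEquiv.ofBijective f hb, hf⟩

theorem asModule_smul (M : FDMod k A) (a : A) (m : M.asModule) : a • m = M.act a m := rfl

instance (M : FDMod k A) : Module k M.asModule := inferInstanceAs (Module k M.carrier)

instance (M : FDMod k A) : IsScalarTower k A M.asModule :=
  ⟨fun c a m => by
    rw [asModule_smul, map_smul]
    rfl⟩

/-- A subspace stable under the action, as a module. -/
noncomputable def sub (M : FDMod k A) (U : Submodule k M.carrier)
    (hU : ∀ a, ∀ m ∈ U, M.act a m ∈ U) : FDMod k A where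
  carrier := U
  act :=
    { toFun := fun a => (M.act a).restrict (hU a)
      map_one' := by ext; simp
      map_mul' := fun a b => by ext; simp
      map_zero' := by ext; simp
      map_add' := fun a b => by ext; simp
      commutes' := fun c => by ext; simp }

theorem iso_sum_of_isCompl (M : FDMod k A) {U W : Submodule k M.carrier} (h : IsCompl U W)
    (hU : ∀ a, ∀ m ∈ U, M.act a m ∈ U) (hW : ∀ a, ∀ m ∈ W, M.act a m ∈ W) :
    Iso M ((M.sub U hU).sum (M.sub W hW)) := by
  refine Iso.symm ⟨Submodule.prodEquivOfIsCompl U W h, ?_⟩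
  exact fun a p => (map_add (M.act a) (p.1 : U).1 (p.2 : W).1).symm

theorem Iso.finrank_eq {M N : FDMod k A} : Iso M N →
    Module.finrank k M.carrier = Module.finrank k N.carrier :=
  fun ⟨e, _⟩ => e.finrank_eq

theorem finrank_sum (M N : FDMod k A) : Module.finrank k (M.sum N).carrier =
    Module.finrank k M.carrier + Module.finrank k N.carrier :=
  Module.finrank_prod

theorem iso_of_subsingleton {M N : FDMod k A} (hM : Subsingleton M.carrier)
    (hN : Subsingleton N.carrier) : Iso M N :=
  ⟨0, fun _ _ => Subsingleton.elim _ _⟩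

theorem iso_sum_self_of_subsingleton (M : FDMod k A) (hM : Subsingleton M.carrier) :
    Iso M (M.sum M) :=
  iso_of_subsingleton hM (inferInstanceAs (Subsingleton (M.carrier × M.carrier)))

end Ring

/-! ### Distributivity of tensor products over direct sums. -/

section Bialgebra

variable {A : Type v} [Ring A] [Bialgebra k A]

section Unbundled

variable {V W X : Type*} [AddCommGroup V] [Module k V] [AddCommGroup W] [Module k W]
  [AddCommGroup X] [Module k X]

theorem tensorAct_prodRight (θ : A →ₐ[k] Module.End k X) (ρ : A →ₐ[k] Module.End k V)
    (σ : A →ₐ[k] Module.End k W) (a : A) (t : X ⊗[k] (V × W)) :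
    TensorProduct.prodRight k k X V W
        (tensorAct θ ((LinearMap.prodMapAlgHom k V W).comp (ρ.prod σ)) a t) =
      (tensorAct θ ρ a (TensorProduct.prodRight k k X V W t).1,
        tensorAct θ σ a (TensorProduct.prodRight k k X V W t).2) := by
  induction t with
  | zero => simp; rfl
  | add s t hs ht => simp [hs, ht]
  | tmul x p =>
    have r := Coalgebra.Repr.arbitrary k a
    rw [tensorAct_repr _ _ r, map_sum, TensorProduct.prodRight_tmul, tensorAct_repr _ _ r,
      tensorAct_repr _ _ r]
    refine Prod.ext ?_ ?_
    · rw [Prod.fst_sum]; rfl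
    · rw [Prod.snd_sum]; rfl

theorem tensorAct_prodLeft (θ : A →ₐ[k] Module.End k X) (ρ : A →ₐ[k] Module.End k V)
    (σ : A →ₐ[k] Module.End k W) (a : A) (t : (V × W) ⊗[k] X) :
    TensorProduct.prodLeft k k V W X
        (tensorAct ((LinearMap.prodMapAlgHom k V W).comp (ρ.prod σ)) θ a t) =
      (tensorAct ρ θ a (TensorProduct.prodLeft k k V W X t).1,
        tensorAct σ θ a (TensorProduct.prodLeft k k V W X t).2) := by
  induction t with
  | zero => simp; rfl
  | add s t hs ht => simp [hs, ht]
  | tmul p x =>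
    have r := Coalgebra.Repr.arbitrary k a
    rw [tensorAct_repr _ _ r, map_sum, TensorProduct.prodLeft_tmul, tensorAct_repr _ _ r,
      tensorAct_repr _ _ r]
    refine Prod.ext ?_ ?_
    · rw [Prod.fst_sum]; rfl
    · rw [Prod.snd_sum]; rfl

end Unbundled

theorem tensor_sum (X M N : FDMod k A) :
    Iso (X.tensor (M.sum N)) ((X.tensor M).sum (X.tensor N)) :=
  ⟨TensorProduct.prodRight k k X.carrier M.carrier N.carrier,
    tensorAct_prodRight X.act M.act N.act⟩

theorem sum_tensor (X M N : FDMod k A) :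
    Iso ((M.sum N).tensor X) ((M.tensor X).sum (N.tensor X)) :=
  ⟨TensorProduct.prodLeft k k M.carrier N.carrier X.carrier,
    tensorAct_prodLeft X.act M.act N.act⟩

end Bialgebra

end FDMod

/-! ### The additive group of the Green ring. -/

namespace GreenRing

variable {k : Type u} [Field k] {A : Type v} [Ring A] [Bialgebra k A]

variable (k A) in
/-- The additive group generated by the relations `[M ⊕ N] - [M] - [N]`. -/
noncomputable def relSubgroup : AddSubgroup (FreeGreen k A) :=
  AddSubgroup.closure {x | ∃ a b, GreenRel k A a b ∧ x = a - b}

/-- Tensoring with `X` distributes over direct sums, so it carries each generating relation to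
another one. With the mirror statement below, the additive span of the relations is already an
ideal. -/
theorem relSubgroup_of_mul (X : FDMod k A) {x : FreeGreen k A} (hx : x ∈ relSubgroup k A) :
    FreeGreen.of X * x ∈ relSubgroup k A := by
  induction hx using AddSubgroup.closure_induction with
  | zero => rw [mul_zero]; exact zero_mem _
  | add x y _ _ hx hy => rw [mul_add]; exact add_mem hx hy
  | neg x _ hx => rw [mul_neg]; exact neg_mem hx
  | mem x hx =>
    obtain ⟨_, _, ⟨M, N⟩, rfl⟩ := hx
    have h (Y : FDMod k A) : FreeGreen.of X * FreeGreen.of Y = FreeGreen.of (X.tensor Y) :=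
      FreeAbelianGroup.of_mul_of _ _
    rw [mul_sub, mul_add, h, h, h, show FreeGreen.of (X.tensor (M.sum N)) =
      FreeGreen.of ((X.tensor M).sum (X.tensor N)) from
        congrArg FreeAbelianGroup.of (Quotient.sound (FDMod.tensor_sum X M N))]
    exact AddSubgroup.subset_closure ⟨_, _, ⟨_, _⟩, rfl⟩

theorem relSubgroup_mul_of (X : FDMod k A) {x : FreeGreen k A} (hx : x ∈ relSubgroup k A) :
    x * FreeGreen.of X ∈ relSubgroup k A := by
  induction hx using AddSubgroup.closure_induction with
  | zero => rw [zero_mul]; exact zero_mem _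
  | add x y _ _ hx hy => rw [add_mul]; exact add_mem hx hy
  | neg x _ hx => rw [neg_mul]; exact neg_mem hx
  | mem x hx =>
    obtain ⟨_, _, ⟨M, N⟩, rfl⟩ := hx
    have h (Y : FDMod k A) : FreeGreen.of Y * FreeGreen.of X = FreeGreen.of (Y.tensor X) :=
      FreeAbelianGroup.of_mul_of _ _
    rw [sub_mul, add_mul, h, h, h, show FreeGreen.of ((M.sum N).tensor X) =
      FreeGreen.of ((M.tensor X).sum (N.tensor X)) from
        congrArg FreeAbelianGroup.of (Quotient.sound (FDMod.sum_tensor X M N))]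
    exact AddSubgroup.subset_closure ⟨_, _, ⟨_, _⟩, rfl⟩

theorem freeGreen_induction {P : FreeGreen k A → Prop} (zero : P 0)
    (of : ∀ M, P (FreeGreen.of M)) (neg : ∀ x, P x → P (-x))
    (add : ∀ x y, P x → P y → P (x + y)) (x : FreeGreen k A) : P x := by
  have of' : ∀ c : FDModClass k A, P (FreeAbelianGroup.of c) := by
    rintro ⟨M⟩
    exact of M
  exact FreeAbelianGroup.induction_on x zero of' (fun c h => neg _ h) add

variable (k A) in
/-- The ideal generated by the relations is additively generated by them. -/
noncomputable def relIdeal : TwoSidedIdeal (FreeGreen k A) :=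
  TwoSidedIdeal.mk' (relSubgroup k A) (zero_mem _) (fun h h' => add_mem h h') (fun h => neg_mem h)
    (by
      intro x y hy
      induction x using freeGreen_induction with
      | zero => rw [zero_mul]; exact zero_mem _
      | of M => exact relSubgroup_of_mul M hy
      | neg x hx => rw [neg_mul]; exact neg_mem hx
      | add x x' hx hx' => rw [add_mul]; exact add_mem hx hx')
    (by
      intro x y hx
      induction y using freeGreen_induction with
      | zero => rw [mul_zero]; exact zero_mem _
      | of M => exact relSubgroup_mul_of M hx
      | neg x hx => rw [mul_neg]; exact neg_mem hx
      | add x x' hx hx' => rw [mul_add]; exact add_mem hx hx')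

variable (k A) in
/-- The quotient map from the free abelian group. -/
noncomputable def mk : FreeGreen k A →+* GreenRing k A := RingQuot.mkRingHom (GreenRel k A)

theorem mk_surjective : Function.Surjective (mk k A) := RingQuot.mkRingHom_surjective _

/-- The Green ring maps to the quotient by `relIdeal`, so whatever vanishes in it lies in
`relIdeal`. This makes it possible to define maps out of the Green ring that are only additive, as
`fixedGreen` will be. -/
theorem mem_relSubgroup_of_mk_eq_zero {x : FreeGreen k A} (hx : mk k A x = 0) :
    x ∈ relSubgroup k A := by
  let L : GreenRing k A →+* (relIdeal k A).ringCon.Quotient :=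
    RingQuot.lift ⟨(relIdeal k A).ringCon.mk', fun {a b} hab => by
      refine (RingCon.eq _).2 ((TwoSidedIdeal.rel_iff _ _ _).2 ?_)
      exact (TwoSidedIdeal.mem_mk' _ _ _ _ _ _ _).2 (AddSubgroup.subset_closure ⟨_, _, hab, rfl⟩)⟩
  have h : L (mk k A x) = (relIdeal k A).ringCon.mk' x := RingQuot.lift_mkRingHom_apply _ _ _
  rw [hx, map_zero] at h
  have h' : (relIdeal k A).ringCon x 0 := (RingCon.eq _).1
    (h.symm.trans (map_zero (relIdeal k A).ringCon.mk').symm)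
  exact (TwoSidedIdeal.mem_mk' _ _ _ _ _ _ _).1 ((TwoSidedIdeal.mem_iff _ _).2 h')

section liftAdd

variable {B : Type*} [AddCommGroup B] (f : FDMod k A → B)
  (hf : ∀ M N : FDMod k A, M.Iso N → f M = f N)

/-- An invariant of modules induces a homomorphism of the free abelian group on the isomorphism
classes. -/
noncomputable def freeLift : FreeGreen k A →+ B :=
  FreeAbelianGroup.lift (fun c : FDModClass k A => Quotient.lift f hf c)

theorem freeLift_of (M : FDMod k A) : freeLift f hf (FreeGreen.of M) = f M :=
  FreeAbelianGroup.lift_apply_of _ _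

theorem relSubgroup_le_ker (hs : ∀ M N, f (M.sum N) = f M + f N) :
    relSubgroup k A ≤ (freeLift f hf).ker := by
  refine (AddSubgroup.closure_le _).2 ?_
  rintro _ ⟨_, _, ⟨M, N⟩, rfl⟩
  refine AddMonoidHom.mem_ker.2 ?_
  rw [map_sub, map_add, freeLift_of, freeLift_of, freeLift_of, hs, sub_self]

/-- An additive invariant of modules induces a homomorphism of the additive group of the Green
ring. -/
noncomputable def liftAdd (hs : ∀ M N, f (M.sum N) = f M + f N) : GreenRing k A →+ B :=
  AddMonoidHom.liftOfSurjective (mk k A : FreeGreen k A →+ GreenRing k A) mk_surjective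
    ⟨freeLift f hf, fun _ hx => relSubgroup_le_ker f hf hs (mem_relSubgroup_of_mk_eq_zero hx)⟩

theorem liftAdd_cls (hs : ∀ M N, f (M.sum N) = f M + f N) (M : FDMod k A) :
    liftAdd f hf hs (cls M) = f M :=
  (AddMonoidHom.liftOfRightInverse_comp_apply
    (mk k A : FreeGreen k A →+ GreenRing k A) _ (Function.rightInverse_surjInv mk_surjective)
    ⟨freeLift f hf, _⟩ (FreeGreen.of M)).trans (freeLift_of f hf M)

end liftAdd

theorem induction {P : GreenRing k A → Prop} (zero : P 0) (cls : ∀ M, P (cls M))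
    (neg : ∀ x, P x → P (-x)) (add : ∀ x y, P x → P y → P (x + y)) (x : GreenRing k A) : P x := by
  obtain ⟨x, rfl⟩ := mk_surjective x
  induction x using freeGreen_induction with
  | zero => rw [map_zero]; exact zero
  | of M => exact cls M
  | neg x hx => rw [map_neg]; exact neg _ hx
  | add x y hx hy => rw [map_add]; exact add _ _ hx hy

/-- A zero module is isomorphic to its own double. -/
theorem cls_eq_zero (M : FDMod k A) (hM : Subsingleton M.carrier) : cls M = 0 := by
  have h := (cls_congr (FDMod.iso_sum_self_of_subsingleton M hM)).trans (cls_sum M M)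
  exact left_eq_add.1 h

/-- Induction on the dimension: a decomposable module has two nonzero summands of smaller dimension,
and `Q` passes to both. It is applied with `Q` projectivity. -/
theorem cls_mem_closure_indecomposable {Q : FDMod k A → Prop}
    (hQ : ∀ M X Y : FDMod k A, M.Iso (X.sum Y) → Q M → Q X ∧ Q Y) (M : FDMod k A) (hM : Q M) :
    cls M ∈ AddSubgroup.closure {x | ∃ M : FDMod k A, M.IsIndecomposable ∧ Q M ∧ x = cls M} := by
  induction hd : Module.finrank k M.carrier using Nat.strong_induction_on generalizing M with
  | _ d ih =>
    by_cases h0 : Subsingleton M.carrier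
    · rw [cls_eq_zero M h0]; exact zero_mem _
    by_cases hi : M.IsIndecomposable
    · exact AddSubgroup.subset_closure ⟨M, hi, hM, rfl⟩
    have hnt := not_subsingleton_iff_nontrivial.1 h0
    rw [FDMod.IsIndecomposable, not_and] at hi
    have hi' := hi hnt
    push Not at hi'
    obtain ⟨X, Y, hXY, hX, hY⟩ := hi'
    rw [cls_congr hXY, cls_sum]
    have hd' := hXY.finrank_eq
    rw [FDMod.finrank_sum] at hd'
    have hX' := Module.finrank_pos_iff (R := k) (M := X.carrier) |>.2 hX
    have hY' := Module.finrank_pos_iff (R := k) (M := Y.carrier) |>.2 hY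
    obtain ⟨qX, qY⟩ := hQ M X Y hXY hM
    exact add_mem (ih _ (by omega) X qX rfl) (ih _ (by omega) Y qY rfl)

end GreenRing

/-! ### Averaging over a finite group. -/

namespace Representation

variable {k : Type*} [Field k] {G : Type*} [Group G] [Finite G]
  {V W : Type*} [AddCommGroup V] [Module k V] [AddCommGroup W] [Module k W]
  (ρ : Representation k G V) (σ : Representation k G W)

/-- The average of the conjugates of a linear map. -/
noncomputable def conjAverage (f : V →ₗ[k] W) : V →ₗ[k] W :=
  letI := Fintype.ofFinite G
  (Nat.card G : k)⁻¹ • ∑ h : G, σ h ∘ₗ f ∘ₗ ρ h⁻¹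

theorem conjAverage_comm (f : V →ₗ[k] W) (h : G) (v : V) :
    conjAverage ρ σ f (ρ h v) = σ h (conjAverage ρ σ f v) := by
  let _ : Fintype G := Fintype.ofFinite G
  simp only [conjAverage, LinearMap.smul_apply, LinearMap.sum_apply, LinearMap.comp_apply,
    map_smul, map_sum]
  congr 1
  refine Fintype.sum_equiv (Equiv.mulLeft h⁻¹) _ _ fun x => ?_
  rw [Equiv.coe_mulLeft, ← Module.End.mul_apply (ρ x⁻¹), ← map_mul, ← Module.End.mul_apply (σ h),
    ← map_mul]
  simp

theorem conjAverage_mem (f : V →ₗ[k] W) {U : Submodule k W} (hU : ∀ h, ∀ w ∈ U, σ h w ∈ U) (v : V)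
    (hf : ∀ h, f (ρ h v) ∈ U) : conjAverage ρ σ f v ∈ U := by
  let _ : Fintype G := Fintype.ofFinite G
  simp only [conjAverage, LinearMap.smul_apply, LinearMap.sum_apply, LinearMap.comp_apply]
  exact U.smul_mem _ (sum_mem fun h _ => hU _ _ (hf _))

/-- All `|G|` terms of the sum have the same image `x`, and the factor `1/|G|` compensates. Both
forms of Maschke's theorem below rest on this: `p` is the given surjection in one and the identity
in the other. -/
theorem map_conjAverage [CharZero k] {X : Type*} [AddCommGroup X] [Module k X] (f : V →ₗ[k] W)
    (p : W →ₗ[k] X) (v : V) (x : X) (h : ∀ h, p (σ h (f (ρ h⁻¹ v))) = x) :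
    p (conjAverage ρ σ f v) = x := by
  let _ : Fintype G := Fintype.ofFinite G
  simp only [conjAverage, LinearMap.smul_apply, LinearMap.sum_apply, LinearMap.comp_apply,
    map_smul, map_sum, h, Finset.sum_const, Finset.card_univ, ← Nat.card_eq_fintype_card]
  rw [← Nat.cast_smul_eq_nsmul k, smul_smul,
    inv_mul_cancel₀ (Nat.cast_ne_zero.2 Nat.card_pos.ne'), one_smul]

/-- Since `p` is equivariant, every conjugate of a linear section is a section, and so is their
average. -/
theorem exists_section [CharZero k] (p : W →ₗ[k] V) (hp : Function.Surjective p)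
    (hc : ∀ h w, p (σ h w) = ρ h (p w)) :
    ∃ s : V →ₗ[k] W, (∀ v, p (s v) = v) ∧ ∀ h v, s (ρ h v) = σ h (s v) := by
  obtain ⟨s, hs⟩ := p.exists_rightInverse_of_surjective (LinearMap.range_eq_top.2 hp)
  refine ⟨conjAverage ρ σ s, fun v => map_conjAverage ρ σ s p v v fun h => ?_,
    conjAverage_comm ρ σ s⟩
  rw [hc, ← LinearMap.comp_apply p, hs, LinearMap.id_apply, ← Module.End.mul_apply, ← map_mul,
    mul_inv_cancel, map_one, Module.End.one_apply]

/-- The average of the conjugates of a projection onto `U` is an equivariant projection onto `U`;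
its kernel is the complement. -/
theorem exists_isCompl [CharZero k] (U : Submodule k V) (hU : ∀ h, ∀ v ∈ U, ρ h v ∈ U) :
    ∃ W : Submodule k V, IsCompl U W ∧ ∀ h, ∀ v ∈ W, ρ h v ∈ W := by
  obtain ⟨f, hf⟩ := U.subtype.exists_leftInverse_of_injective U.ker_subtype
  let e := conjAverage ρ ρ (U.subtype ∘ₗ f)
  have he : LinearMap.IsProj U e := by
    refine ⟨fun v => conjAverage_mem ρ ρ _ hU v fun h => (f _).2, fun v hv => ?_⟩
    refine map_conjAverage ρ ρ _ LinearMap.id v v fun h => ?_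
    have h1 : f (ρ h⁻¹ v) = ⟨ρ h⁻¹ v, hU _ _ hv⟩ := LinearMap.congr_fun hf ⟨ρ h⁻¹ v, hU _ _ hv⟩
    rw [LinearMap.comp_apply, h1, LinearMap.id_apply, Submodule.subtype_apply,
      ← Module.End.mul_apply, ← map_mul, mul_inv_cancel, map_one, Module.End.one_apply]
  refine ⟨LinearMap.ker e, he.isCompl, fun h v hv => ?_⟩
  rw [LinearMap.mem_ker] at hv ⊢
  rw [conjAverage_comm, hv, map_zero]

end Representation

namespace GroupDatum

/-! ### The cyclic shift that models the action of `y` on induced modules. -/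

section WrapShift

variable {k : Type*} [Field k] {V N : Type*} [AddCommGroup V] [Module k V] [AddCommGroup N]
  [Module k N]

/-- The shift `xⁱ v ↦ xⁱ⁺¹ v` for `i ≤ n - 2`, and `x^{n-1} v ↦ c v`. -/
def wrapShift (c : Module.End k V) (n : ℕ) : Module.End k (Fin n → V) where
  toFun f i := if (i : ℕ) = 0 then c (f ⟨n - 1, Nat.sub_one_lt_of_lt i.2⟩)
    else f ⟨i - 1, lt_of_le_of_lt (Nat.sub_le _ _) i.2⟩
  map_add' f f' := by ext i; by_cases h : (i : ℕ) = 0 <;> simp [h]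
  map_smul' c f := by ext i; by_cases h : (i : ℕ) = 0 <;> simp [h]

theorem wrapShift_apply (c : Module.End k V) {n : ℕ} (f : Fin n → V) (i : Fin n) :
    wrapShift c n f i = if (i : ℕ) = 0 then c (f ⟨n - 1, Nat.sub_one_lt_of_lt i.2⟩)
      else f ⟨i - 1, lt_of_le_of_lt (Nat.sub_le _ _) i.2⟩ := rfl

/-- In at most `n` steps a coordinate passes the end at most once, so `c` is applied at most once.
-/
theorem wrapShift_pow (c : Module.End k V) {n m : ℕ} (hm : m ≤ n) (f : Fin n → V) (i : Fin n) :
    (wrapShift c n ^ m) f i = if h : (i : ℕ) < m then c (f ⟨i + n - m, by omega⟩)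
      else f ⟨i - m, lt_of_le_of_lt (Nat.sub_le _ _) i.2⟩ := by
  induction m generalizing i with
  | zero => simp
  | succ m ih =>
    rw [pow_succ', Module.End.mul_apply, wrapShift_apply, ih (by omega), ih (by omega)]
    by_cases h0 : (i : ℕ) = 0
    · rw [if_pos h0, dif_neg (by simp only; omega), dif_pos (by omega)]
      congr 3
      simp only
      omega
    · by_cases h1 : (i : ℕ) < m + 1
      · rw [if_neg h0, dif_pos (by simp only; omega), dif_pos h1]
        congr 3
        simp only
        omega
      · rw [if_neg h0, dif_neg (by simp only; omega), dif_neg h1]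
        congr 2
        simp only
        omega

theorem wrapShift_pow_self (c : Module.End k V) {n : ℕ} (f : Fin n → V) (i : Fin n) :
    (wrapShift c n ^ n) f i = c (f i) := by
  rw [wrapShift_pow c le_rfl, dif_pos i.2]
  simp

theorem wrapShift_single (c : Module.End k V) {n : ℕ} (i : ℕ) (hi : i + 1 < n) (v : V) :
    wrapShift c n (Pi.single ⟨i, by omega⟩ v) = Pi.single ⟨i + 1, hi⟩ v := by
  ext j
  rw [wrapShift_apply]
  by_cases h0 : (j : ℕ) = 0
  · rw [if_pos h0, Pi.single_eq_of_ne, Pi.single_eq_of_ne, map_zero]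
    · rw [Ne, Fin.ext_iff]; simp only; omega
    · rw [Ne, Fin.ext_iff]; simp only; omega
  · rw [if_neg h0, Pi.single_apply, Pi.single_apply]
    refine if_congr ?_ rfl rfl
    rw [Fin.ext_iff, Fin.ext_iff]
    simp only
    omega

/-- The two sums agree term by term after a shift of the index; the term that wraps round is matched
by the hypothesis on `Yⁿ`. -/
theorem sum_wrapShift {n : ℕ} (Y : Module.End k N) (φ : V →ₗ[k] N) (c : Module.End k V)
    (h : ∀ v, (Y ^ n) (φ v) = φ (c v)) (f : Fin n → V) :
    ∑ i : Fin n, (Y ^ (i : ℕ)) (φ (wrapShift c n f i)) =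
      Y (∑ i : Fin n, (Y ^ (i : ℕ)) (φ (f i))) := by
  cases n with
  | zero => simp
  | succ n =>
    rw [Fin.sum_univ_succ, map_sum, Fin.sum_univ_castSucc, add_comm]
    congr 1
    · refine Finset.sum_congr rfl fun i _ => ?_
      rw [← Module.End.mul_apply Y, ← pow_succ']
      rfl
    · rw [← Module.End.mul_apply Y, ← pow_succ']
      exact (h _).symm

/-- The map `t` moves the last coordinate to place `0` and kills the others. In term `i`, the first
shift brings coordinate `i` to the last place, `t` moves it to place `0`, and the second shift
returns it to place `i`. So term `i` is the projection to coordinate `i`; no surviving coordinate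
wraps round, and `c` drops out. -/
theorem sum_wrapShift_trace (c : Module.End k V) {n : ℕ} (t : Module.End k (Fin n → V))
    (ht : ∀ (f : Fin n → V) (i : Fin n),
      t f i = if (i : ℕ) = 0 then f ⟨n - 1, Nat.sub_one_lt_of_lt i.2⟩ else 0) (f : Fin n → V) :
    ∑ i ∈ Finset.range n, (wrapShift c n ^ i) (t ((wrapShift c n ^ (n - 1 - i)) f)) = f := by
  ext j
  rw [Finset.sum_apply, Finset.sum_eq_single (j : ℕ)]
  · rw [wrapShift_pow c j.2.le, dif_neg (lt_irrefl _), ht, if_pos (Nat.sub_self _),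
      wrapShift_pow c (by omega), dif_neg (by simp only; omega)]
    congr 1
    rw [Fin.ext_iff]
    simp only
    omega
  · intro i hi hij
    have hi := Finset.mem_range.1 hi
    rw [wrapShift_pow c hi.le]
    split_ifs with h
    · rw [ht, if_neg (by simp only; omega), map_zero]
    · rw [ht, if_neg (by simp only; omega)]
  · intro h
    exact absurd (Finset.mem_range.2 j.2) h

end WrapShift

/-! ### Commutation rules in `H` and on its modules. -/

variable {k : Type u} [Field k] {G : Type v} [Group G] (D : GroupDatum k G)

theorem gr_mul_y (h : G) : D.gr h * D.y = (((D.χ h)⁻¹ : kˣ) : k) • (D.y * D.gr h) := by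
  rw [y_mul, smul_smul, ← Units.val_mul, inv_mul_cancel, Units.val_one, one_smul]

theorem gr_mul_y_pow (h : G) (i : ℕ) :
    D.gr h * D.y ^ i = (((D.χ h)⁻¹ ^ i : kˣ) : k) • (D.y ^ i * D.gr h) := by
  induction i with
  | zero => simp
  | succ i ih =>
    rw [pow_succ', ← mul_assoc, gr_mul_y, smul_mul_assoc, mul_assoc, ih, mul_smul_comm, smul_smul,
      ← Units.val_mul, ← pow_succ', mul_assoc]

variable {V W : Type*} [AddCommGroup V] [Module k V] [AddCommGroup W] [Module k W]

variable {D}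

/-- The restriction of an `H`-module to the group. -/
noncomputable def rep (α : D.H →ₐ[k] Module.End k V) : Representation k G V :=
  (α : D.H →* Module.End k V).comp D.gr

theorem rep_apply (α : D.H →ₐ[k] Module.End k V) (h : G) : rep α h = α (D.gr h) := rfl

theorem map_act_of_generators {α : D.H →ₐ[k] Module.End k V} {β : D.H →ₐ[k] Module.End k W}
    {f : V →ₗ[k] W} (hy : ∀ m, f (α D.y m) = β D.y (f m))
    (hgr : ∀ h m, f (α (D.gr h) m) = β (D.gr h) (f m)) (a : D.H) :
    ∀ m, f (α a m) = β a (f m) := by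
  refine induction (P := fun a => ∀ m, f (α a m) = β a (f m)) ?_ hy hgr ?_ ?_ a
  · intro c m
    rw [AlgHom.commutes, AlgHom.commutes, Module.algebraMap_end_apply, Module.algebraMap_end_apply,
      map_smul]
  · intro a b ha hb m
    rw [map_mul, map_mul, Module.End.mul_apply, ha, hb, Module.End.mul_apply]
  · intro a b ha hb m
    rw [map_add, map_add, LinearMap.add_apply, map_add, ha, hb, LinearMap.add_apply]

theorem act_y_pow_n (α : D.H →ₐ[k] Module.End k V) (m : V) :
    (α D.y ^ D.n) m = D.μ • (rep α (D.g ^ D.n) m - m) := by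
  rw [← map_pow, y_pow, map_smul, map_sub, map_one]
  rfl

theorem act_gr_y_pow (α : D.H →ₐ[k] Module.End k V) (h : G) (i : ℕ) (m : V) :
    α (D.gr h) ((α D.y ^ i) m) =
      (((D.χ h)⁻¹ ^ i : kˣ) : k) • (α D.y ^ i) (α (D.gr h) m) := by
  rw [← map_pow, ← Module.End.mul_apply, ← map_mul, gr_mul_y_pow, map_smul, map_mul]
  rfl

/-! ### Modules induced from `kG`. -/

section Induced

variable (D) {V : Type u} [AddCommGroup V] [Module k V]

/-- The action of `H_D` on `H_D ⊗_{kG} V`, identified with `V ⊕ xV ⊕ ⋯ ⊕ x^{n-1}V`. -/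
noncomputable def inducedAct (hχ : D.χ ^ D.n = 1) (ρ : Representation k G V) :
    D.H →ₐ[k] Module.End k (Fin D.n → V) :=
  D.lift (D.stringGrp ρ D.n) (wrapShift (D.μ • (ρ (D.g ^ D.n) - 1)) D.n)
    (by
      refine LinearMap.ext fun f => funext fun i => ?_
      rw [wrapShift_pow_self]
      change D.μ • (ρ (D.g ^ D.n) (f i) - f i) =
        D.μ • ((((D.χ (D.g ^ D.n))⁻¹ ^ (i : ℕ) : kˣ) : k) • ρ (D.g ^ D.n) (f i) - f i)
      rw [χ_g_pow_n]
      simp)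
    (by
      intro h
      have hc : ∀ v, (D.μ • (ρ (D.g ^ D.n) - 1)) (ρ h v) =
          ρ h ((D.μ • (ρ (D.g ^ D.n) - 1)) v) := by
        intro v
        simp only [LinearMap.smul_apply, LinearMap.sub_apply, Module.End.one_apply, map_smul,
          map_sub]
        rw [← Module.End.mul_apply, ← map_mul, ← Subgroup.mem_center_iff.1 D.pow_mem_center h,
          map_mul, Module.End.mul_apply]
      refine LinearMap.ext fun f => funext fun i => ?_
      change wrapShift _ _ (D.stringGrp ρ D.n h f) i = (D.χ h : k) •
        (((D.χ h)⁻¹ ^ (i : ℕ) : kˣ) : k) • ρ h (wrapShift _ _ f i)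
      rw [wrapShift_apply, wrapShift_apply]
      change (if (i : ℕ) = 0 then (D.μ • (ρ (D.g ^ D.n) - 1)) ((((D.χ h)⁻¹ ^ (D.n - 1) : kˣ) : k) •
          ρ h (f ⟨D.n - 1, Nat.sub_one_lt_of_lt i.2⟩)) else (((D.χ h)⁻¹ ^ ((i : ℕ) - 1) : kˣ) : k) •
          ρ h (f ⟨i - 1, lt_of_le_of_lt (Nat.sub_le _ _) i.2⟩)) = _
      by_cases h0 : (i : ℕ) = 0
      · rw [if_pos h0, if_pos h0, map_smul, hc,
          show ((D.χ h)⁻¹ ^ (i : ℕ) : kˣ) = 1 by rw [h0, pow_zero], Units.val_one, one_smul]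
        congr 2
        -- The wrapped coordinate carries the scalar `χ(h)⁻⁽ⁿ⁻¹⁾`, while the relation `yh = χ(h)hy`
        -- asks for `χ(h)`; they agree because `χⁿ = 1`.
        have h1 : D.χ h ^ D.n = 1 := DFunLike.congr_fun hχ h
        have h2 : D.n = D.n - 1 + 1 := by have := i.2; omega
        rw [h2, pow_succ] at h1
        rw [inv_pow]
        exact inv_eq_of_mul_eq_one_right h1
      · rw [if_neg h0, if_neg h0, smul_smul, ← Units.val_mul]
        congr 3
        conv_rhs => rw [show (i : ℕ) = (i : ℕ) - 1 + 1 by omega, pow_succ', mul_inv_cancel_left])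

/-- The `H_D`-module induced from a `kG`-module. -/
noncomputable def induced (hχ : D.χ ^ D.n = 1) {V : Type u} [AddCommGroup V] [Module k V]
    [FiniteDimensional k V] (ρ : Representation k G V) : FDMod k D.H where
  carrier := Fin D.n → V
  act := D.inducedAct hχ ρ

variable {D} (hχ : D.χ ^ D.n = 1) (ρ : Representation k G V)

theorem inducedAct_y : D.inducedAct hχ ρ D.y = wrapShift (D.μ • (ρ (D.g ^ D.n) - 1)) D.n :=
  lift_y

theorem inducedAct_gr (h : G) : D.inducedAct hχ ρ (D.gr h) = D.stringGrp ρ D.n h := lift_gr h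

theorem stringGrp_apply (h : G) {j : ℕ} (f : Fin j → V) (i : Fin j) :
    D.stringGrp ρ j h f i = (((D.χ h)⁻¹ ^ (i : ℕ) : kˣ) : k) • ρ h (f i) := rfl

/-- The `H_D`-linear extension of a `kG`-linear map. -/
noncomputable def ofInduced (α : D.H →ₐ[k] Module.End k W) (φ : V →ₗ[k] W) :
    (Fin D.n → V) →ₗ[k] W :=
  ∑ i : Fin D.n, (α D.y ^ (i : ℕ)) ∘ₗ φ ∘ₗ LinearMap.proj i

theorem ofInduced_apply (α : D.H →ₐ[k] Module.End k W) (φ : V →ₗ[k] W) (f : Fin D.n → V) :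
    ofInduced α φ f = ∑ i : Fin D.n, (α D.y ^ (i : ℕ)) (φ (f i)) := by
  simp [ofInduced]

theorem ofInduced_single [Finite G] (α : D.H →ₐ[k] Module.End k W) (φ : V →ₗ[k] W) (v : V) :
    ofInduced α φ (Pi.single ⟨0, Nat.pos_of_ne_zero D.n_ne_zero⟩ v) = φ v := by
  rw [ofInduced_apply, Finset.sum_eq_single ⟨0, Nat.pos_of_ne_zero D.n_ne_zero⟩]
  · simp
  · intro i _ hi
    rw [Pi.single_eq_of_ne hi, map_zero, map_zero]
  · simp

/-- Frobenius reciprocity. For `y` this is `sum_wrapShift`: on `W` the power `yⁿ` is `μ(gⁿ - 1)`,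
which `φ` intertwines with the wrapping map of the induced module. -/
theorem ofInduced_act (α : D.H →ₐ[k] Module.End k W) (φ : V →ₗ[k] W)
    (hφ : ∀ h v, φ (ρ h v) = rep α h (φ v)) :
    ∀ a f, ofInduced α φ (D.inducedAct hχ ρ a f) = α a (ofInduced α φ f) := by
  refine map_act_of_generators (fun f => ?_) (fun h f => ?_)
  · rw [inducedAct_y, ofInduced_apply, ofInduced_apply]
    refine sum_wrapShift _ _ _ (fun v => ?_) f
    rw [act_y_pow_n, ← hφ]
    simp
  · rw [inducedAct_gr, ofInduced_apply, ofInduced_apply, map_sum]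
    refine Finset.sum_congr rfl fun i _ => ?_
    rw [stringGrp_apply, map_smul, hφ, map_smul, act_gr_y_pow, rep_apply]

end Induced
end GroupDatum

/-! ### Direct summands and their tensor products. -/

namespace FDMod

variable {k : Type u} [Field k]

section Ring

variable {A : Type v} [Ring A] [Algebra k A]

/-- A homomorphism of modules as a linear map over the ring. -/
def IsHom.toLinear {M N : FDMod k A} {f : M.carrier →ₗ[k] N.carrier} (hf : M.IsHom N f) :
    M.asModule →ₗ[A] N.asModule where
  toFun := f
  map_add' := f.map_add
  map_smul' := hf

/-- `M` is a direct summand of `N`. -/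
def IsRetract (M N : FDMod k A) : Prop :=
  ∃ (s : M.carrier →ₗ[k] N.carrier) (p : N.carrier →ₗ[k] M.carrier),
    M.IsHom N s ∧ N.IsHom M p ∧ ∀ m, p (s m) = m

theorem Iso.isRetract {M N : FDMod k A} : Iso M N → IsRetract M N := by
  rintro ⟨e, he⟩
  refine ⟨e.toLinearMap, e.symm.toLinearMap, he, fun a m => ?_, fun m => e.symm_apply_apply m⟩
  exact (LinearEquiv.symm_apply_eq e).2
    (((he a _).trans (congrArg _ (e.apply_symm_apply m))).symm)

theorem IsRetract.trans {M N P : FDMod k A} : IsRetract M N → IsRetract N P → IsRetract M P := by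
  rintro ⟨s, p, hs, hp, h⟩ ⟨s', p', hs', hp', h'⟩
  refine ⟨s' ∘ₗ s, p ∘ₗ p', fun a m => ?_, fun a m => ?_, fun m => ?_⟩
  · rw [LinearMap.comp_apply, hs, hs', LinearMap.comp_apply]
  · rw [LinearMap.comp_apply, hp', hp, LinearMap.comp_apply]
  · rw [LinearMap.comp_apply, LinearMap.comp_apply, h', h]

theorem isRetract_sum_left (M N : FDMod k A) : IsRetract M (M.sum N) :=
  ⟨LinearMap.inl k M.carrier N.carrier, LinearMap.fst k M.carrier N.carrier,
    fun a _ => Prod.ext rfl (map_zero (N.act a)).symm, fun _ _ => rfl, fun _ => rfl⟩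

theorem isRetract_sum_right (M N : FDMod k A) : IsRetract N (M.sum N) :=
  ⟨LinearMap.inr k M.carrier N.carrier, LinearMap.snd k M.carrier N.carrier,
    fun a _ => Prod.ext (map_zero (M.act a)).symm rfl, fun _ _ => rfl, fun _ => rfl⟩

theorem IsProjective.isRetract {M N : FDMod k A} (hM : M.IsProjective)
    {f : N.carrier →ₗ[k] M.carrier} (hf : N.IsHom M f) (hs : Function.Surjective f) :
    IsRetract M N := by
  have : Module.Projective A M.asModule := hM
  obtain ⟨s, h⟩ := Module.projective_lifting_property hf.toLinear LinearMap.id hs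
  exact ⟨s.restrictScalars k, f, fun a m => s.map_smul a m, hf, fun m => LinearMap.congr_fun h m⟩

end Ring

section Bialgebra

variable {A : Type v} [Ring A] [Bialgebra k A]

section Unbundled

variable {V W X : Type*} [AddCommGroup V] [Module k V] [AddCommGroup W] [Module k W]
  [AddCommGroup X] [Module k X]

theorem tensorAct_lTensor (θ : A →ₐ[k] Module.End k X) {ρ : A →ₐ[k] Module.End k V}
    {σ : A →ₐ[k] Module.End k W} {f : V →ₗ[k] W} (hf : ∀ a v, f (ρ a v) = σ a (f v)) (a : A)
    (t : X ⊗[k] V) : f.lTensor X (tensorAct θ ρ a t) = tensorAct θ σ a (f.lTensor X t) := by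
  induction t with
  | zero => simp
  | add s t hs ht => simp only [map_add, hs, ht]
  | tmul x v =>
    have r := Coalgebra.Repr.arbitrary k a
    rw [tensorAct_repr _ _ r, map_sum, LinearMap.lTensor_tmul, tensorAct_repr _ _ r]
    simp only [LinearMap.lTensor_tmul, hf]

theorem tensorAct_rTensor (θ : A →ₐ[k] Module.End k X) {ρ : A →ₐ[k] Module.End k V}
    {σ : A →ₐ[k] Module.End k W} {f : V →ₗ[k] W} (hf : ∀ a v, f (ρ a v) = σ a (f v)) (a : A)
    (t : V ⊗[k] X) : f.rTensor X (tensorAct ρ θ a t) = tensorAct σ θ a (f.rTensor X t) := by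
  induction t with
  | zero => simp
  | add s t hs ht => simp only [map_add, hs, ht]
  | tmul v x =>
    have r := Coalgebra.Repr.arbitrary k a
    rw [tensorAct_repr _ _ r, map_sum, LinearMap.rTensor_tmul, tensorAct_repr _ _ r]
    simp only [LinearMap.rTensor_tmul, hf]

end Unbundled

theorem IsRetract.tensor_left (X : FDMod k A) {M N : FDMod k A} :
    IsRetract M N → IsRetract (X.tensor M) (X.tensor N) := by
  rintro ⟨s, p, hs, hp, h⟩
  refine ⟨s.lTensor X.carrier, p.lTensor X.carrier, tensorAct_lTensor X.act hs,
    tensorAct_lTensor X.act hp, fun (m : X.carrier ⊗[k] M.carrier) => ?_⟩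
  refine (LinearMap.lTensor_comp_apply X.carrier p s m).symm.trans ?_
  rw [show p ∘ₗ s = LinearMap.id from LinearMap.ext h]
  exact LinearMap.lTensor_id_apply _ _ m

theorem IsRetract.tensor_right (X : FDMod k A) {M N : FDMod k A} :
    IsRetract M N → IsRetract (M.tensor X) (N.tensor X) := by
  rintro ⟨s, p, hs, hp, h⟩
  refine ⟨s.rTensor X.carrier, p.rTensor X.carrier, tensorAct_rTensor X.act hs,
    tensorAct_rTensor X.act hp, fun (m : M.carrier ⊗[k] X.carrier) => ?_⟩
  refine (LinearMap.rTensor_comp_apply X.carrier p s m).symm.trans ?_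
  rw [show p ∘ₗ s = LinearMap.id from LinearMap.ext h]
  exact LinearMap.rTensor_id_apply _ _ m

end Bialgebra

end FDMod

/-! ### The trace criterion for projectivity. -/

namespace GroupDatum

variable {k : Type u} [Field k] {G : Type v} [Group G] {D : GroupDatum k G}

/-- The identity of `M` is the image of a linear map under the transfer map. -/
def HasTrace (M : FDMod k D.H) : Prop :=
  ∃ t : Module.End k M.carrier,
    (∀ h m, rep M.act h (t m) = ((D.χ h ^ (D.n - 1) : kˣ) : k) • t (rep M.act h m)) ∧
    ∀ m, ∑ i ∈ Finset.range D.n, (M.act D.y ^ i) (t ((M.act D.y ^ (D.n - 1 - i)) m)) = m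

/-- The inclusion `s` and the projection `p` commute with `y` and with `G`, so `p t s` serves for
the summand. -/
theorem HasTrace.of_isRetract {M N : FDMod k D.H} (hN : HasTrace N) (h : M.IsRetract N) :
    HasTrace M := by
  obtain ⟨t, ht, ht'⟩ := hN
  obtain ⟨s, p, hs, hp, hps⟩ := h
  refine ⟨p ∘ₗ t ∘ₗ s, fun h m => ?_, fun m => ?_⟩
  · rw [LinearMap.comp_apply, LinearMap.comp_apply, rep_apply, ← hp, ← rep_apply, ht, map_smul,
      rep_apply, ← hs, LinearMap.comp_apply, LinearMap.comp_apply]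
  · have key := congrArg p (ht' (s m))
    rw [hps, map_sum] at key
    refine Eq.trans (Finset.sum_congr rfl fun i _ => ?_) key
    rw [← map_pow, ← map_pow, ← map_pow, ← map_pow, hp, ← hs, LinearMap.comp_apply,
      LinearMap.comp_apply]

/-- Take `t` sending `xⁿ⁻¹v` to `v` and killing the other summands, as in `sum_wrapShift_trace`.
Since `h` acts on `xⁿ⁻¹v` with the extra scalar `χ(h)⁻⁽ⁿ⁻¹⁾`, `t` commutes with `G` up to `χⁿ⁻¹`. -/
theorem HasTrace.induced {V : Type u} [AddCommGroup V] [Module k V] [FiniteDimensional k V]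
    (hχ : D.χ ^ D.n = 1) (ρ : Representation k G V) : HasTrace (D.induced hχ ρ) := by
  let t : Module.End k (Fin D.n → V) :=
    { toFun := fun f i => if (i : ℕ) = 0 then f ⟨D.n - 1, Nat.sub_one_lt_of_lt i.2⟩ else 0
      map_add' := fun f f' => by ext i; by_cases h : (i : ℕ) = 0 <;> simp [h]
      map_smul' := fun c f => by ext i; by_cases h : (i : ℕ) = 0 <;> simp [h] }
  refine ⟨t, fun h (f : Fin D.n → V) => ?_, fun (f : Fin D.n → V) => ?_⟩
  · change D.inducedAct hχ ρ (D.gr h) (t f) =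
      ((D.χ h ^ (D.n - 1) : kˣ) : k) • t (D.inducedAct hχ ρ (D.gr h) f)
    rw [inducedAct_gr]
    ext i
    rw [stringGrp_apply, Pi.smul_apply]
    change (((D.χ h)⁻¹ ^ (i : ℕ) : kˣ) : k) • ρ h (if (i : ℕ) = 0 then
        f ⟨D.n - 1, Nat.sub_one_lt_of_lt i.2⟩ else 0) = ((D.χ h ^ (D.n - 1) : kˣ) : k) •
      (if (i : ℕ) = 0 then (((D.χ h)⁻¹ ^ (D.n - 1) : kˣ) : k) •
        ρ h (f ⟨D.n - 1, Nat.sub_one_lt_of_lt i.2⟩) else 0)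
    split_ifs with h0
    · rw [show ((D.χ h)⁻¹ ^ (i : ℕ) : kˣ) = 1 by rw [h0, pow_zero], Units.val_one, one_smul,
        smul_smul, ← Units.val_mul, inv_pow, mul_inv_cancel, Units.val_one, one_smul]
    · simp
  · change ∑ i ∈ Finset.range D.n, (D.inducedAct hχ ρ D.y ^ i)
      (t ((D.inducedAct hχ ρ D.y ^ (D.n - 1 - i)) f)) = f
    rw [inducedAct_y]
    exact sum_wrapShift_trace _ _ (fun _ _ => rfl) f

/-- The module induced from the restriction of `M` to `kG` maps onto `M`. When `M` is projective
this map splits, and the trace is inherited. -/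
theorem hasTrace_of_isProjective [Finite G] (hχ : D.χ ^ D.n = 1) {M : FDMod k D.H}
    (hM : M.IsProjective) : HasTrace M := by
  refine (HasTrace.induced hχ (rep M.act)).of_isRetract
    (hM.isRetract (ofInduced_act hχ (rep M.act) M.act LinearMap.id fun _ _ => rfl) fun m => ?_)
  exact ⟨_, ofInduced_single M.act LinearMap.id m⟩

theorem isLinear_of_generators {P N : Type*} [AddCommGroup P] [Module k P] [Module D.H P]
    [IsScalarTower k D.H P] [AddCommGroup N] [Module k N] [Module D.H N] [IsScalarTower k D.H N]
    {f : P →ₗ[k] N} (hy : ∀ m, f (D.y • m) = D.y • f m)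
    (hgr : ∀ h m, f (D.gr h • m) = D.gr h • f m) (a : D.H) : ∀ m, f (a • m) = a • f m := by
  refine induction (P := fun a => ∀ m, f (a • m) = a • f m) ?_ hy hgr ?_ ?_ a
  · intro c m
    rw [algebraMap_smul, algebraMap_smul, map_smul]
  · intro a b ha hb m
    rw [mul_smul, mul_smul, ha, hb]
  · intro a b ha hb m
    rw [add_smul, add_smul, map_add, ha, hb]

/-- Averaging gives a `kG`-linear section `s` of `p`. Then `∑ yⁱ s t yⁿ⁻¹⁻ⁱ` is `H`-linear, and `p`
sends it to `∑ yⁱ t yⁿ⁻¹⁻ⁱ = 1`. The modules are not assumed finite dimensional, because the free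
covers by which projectivity is tested need not be. -/
theorem exists_linear_section [CharZero k] [Finite G] {P N : Type*} [AddCommGroup P] [Module k P]
    [Module D.H P] [IsScalarTower k D.H P] [AddCommGroup N] [Module k N] [Module D.H N]
    [IsScalarTower k D.H N] (t : P →ₗ[k] P)
    (ht : ∀ h m, D.gr h • t m = ((D.χ h ^ (D.n - 1) : kˣ) : k) • t (D.gr h • m))
    (ht' : ∀ m, ∑ i ∈ Finset.range D.n, D.y ^ i • t (D.y ^ (D.n - 1 - i) • m) = m)
    (p : N →ₗ[D.H] P) (hp : Function.Surjective p) : ∃ s : P →ₗ[D.H] N, p ∘ₗ s = LinearMap.id := by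
  let ρ : Representation k G P :=
    ((Algebra.lsmul k k P : D.H →ₐ[k] Module.End k P) : D.H →* Module.End k P).comp D.gr
  let σ : Representation k G N :=
    ((Algebra.lsmul k k N : D.H →ₐ[k] Module.End k N) : D.H →* Module.End k N).comp D.gr
  obtain ⟨s, hs, hs'⟩ := ρ.exists_section σ (p.restrictScalars k) hp
    (fun h w => p.map_smul (D.gr h) w)
  have hs'' : ∀ h v, s (D.gr h • v) = D.gr h • s v := hs'
  let u : P →ₗ[k] N := s ∘ₗ t
  have hu : ∀ h m, D.gr h • u m = ((D.χ h ^ (D.n - 1) : kˣ) : k) • u (D.gr h • m) := by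
    intro h m
    rw [LinearMap.comp_apply, ← hs'', ht, map_smul, LinearMap.comp_apply]
  -- The twist by `χⁿ⁻¹` is trivial at `gⁿ`, and `yⁿ = μ(gⁿ - 1)`.
  have hu' : ∀ m, u (D.y ^ D.n • m) = D.y ^ D.n • u m := by
    intro m
    have h1 := hu (D.g ^ D.n) m
    rw [χ_g_pow_n, one_pow, Units.val_one, one_smul] at h1
    rw [y_pow, smul_assoc, smul_assoc, sub_smul, sub_smul, one_smul, one_smul, map_smul, map_sub,
      h1]
  let f : P →ₗ[k] N := ∑ i ∈ Finset.range D.n, Algebra.lsmul k k N (D.y ^ i) ∘ₗ u ∘ₗ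
    Algebra.lsmul k k P (D.y ^ (D.n - 1 - i))
  have hf : ∀ m, f m = ∑ i ∈ Finset.range D.n, D.y ^ i • u (D.y ^ (D.n - 1 - i) • m) := by
    intro m
    rw [LinearMap.sum_apply]
    rfl
  have hlin : ∀ (a : D.H) m, f (a • m) = a • f m := by
    refine isLinear_of_generators (fun m => ?_) (fun h m => ?_)
    -- The two sides are the sums of `F` over `0, …, n - 1` and over `1, …, n`; they agree since `F
    -- 0 = F n`.
    · let F : ℕ → N := fun i => D.y ^ i • u (D.y ^ (D.n - i) • m)
      have h1 : f (D.y • m) = ∑ i ∈ Finset.range D.n, F i := by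
        rw [hf]
        refine Finset.sum_congr rfl fun i hi => ?_
        have := Finset.mem_range.1 hi
        rw [smul_smul, ← pow_succ, show D.n - 1 - i + 1 = D.n - i by omega]
      have h2 : D.y • f m = ∑ i ∈ Finset.range D.n, F (i + 1) := by
        rw [hf, Finset.smul_sum]
        refine Finset.sum_congr rfl fun i _ => ?_
        rw [smul_smul, ← pow_succ', show D.n - 1 - i = D.n - (i + 1) by omega]
      have h3 : F 0 = F D.n := by simp [F, hu']
      have h4 := Finset.sum_range_succ F D.n
      rw [Finset.sum_range_succ', h3] at h4
      rw [h1, h2, add_right_cancel h4]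
    -- Moving `h` through term `i` produces `χ(h)⁻ⁱ`, `χ(h)ⁿ⁻¹` and `χ(h)⁻⁽ⁿ⁻¹⁻ⁱ⁾`, whose product is
    -- `1`.
    · rw [hf, hf, Finset.smul_sum]
      refine Finset.sum_congr rfl fun i hi => ?_
      have := Finset.mem_range.1 hi
      have h1 : D.gr h • D.y ^ (D.n - 1 - i) • m =
          (((D.χ h)⁻¹ ^ (D.n - 1 - i) : kˣ) : k) • D.y ^ (D.n - 1 - i) • D.gr h • m := by
        rw [smul_smul, gr_mul_y_pow, smul_assoc, mul_smul]
      rw [smul_smul (D.gr h) (D.y ^ i), gr_mul_y_pow, smul_assoc, mul_smul, hu, h1,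
        u.map_smul, smul_comm (D.y ^ i) (_ : k), smul_comm (D.y ^ i) (_ : k), smul_smul (_ : k),
        smul_smul (_ : k), ← Units.val_mul,
        ← Units.val_mul, inv_pow, inv_pow, show D.n - 1 = i + (D.n - 1 - i) by omega, pow_add,
        inv_mul_cancel_left, Nat.add_sub_cancel_left, mul_inv_cancel, Units.val_one, one_smul]
  refine ⟨{ f with map_smul' := hlin }, LinearMap.ext fun m => ?_⟩
  change p (f m) = m
  rw [hf, map_sum]
  refine Eq.trans (Finset.sum_congr rfl fun i _ => ?_) (ht' m)
  rw [p.map_smul]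
  congr 1
  exact hs _

theorem HasTrace.isProjective [CharZero k] [Finite G] {M : FDMod k D.H} (hM : HasTrace M) :
    M.IsProjective := by
  obtain ⟨t, ht, ht'⟩ := hM
  refine Module.Projective.of_lifting_property'' fun p hp => ?_
  let t' : M.asModule →ₗ[k] M.asModule := t
  refine exists_linear_section t' ht (fun m => ?_) p hp
  refine Eq.trans (Finset.sum_congr rfl fun i _ => ?_) (ht' m)
  rw [FDMod.asModule_smul, FDMod.asModule_smul, map_pow, map_pow]
  rfl

/-! ### The generators on tensor products. -/

section Tensor

variable [Finite G]

variable {V W : Type*} [AddCommGroup V] [Module k V] [AddCommGroup W] [Module k W]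
  (α : D.H →ₐ[k] Module.End k V) (β : D.H →ₐ[k] Module.End k W)

theorem tensorAct_y (v : V) (w : W) : FDMod.tensorAct α β D.y (v ⊗ₜ[k] w) =
    α D.y v ⊗ₜ[k] rep β D.g w + v ⊗ₜ[k] β D.y w := by
  change Module.endTensorEndAlgHom (R := k) (S := k) (A := k)
    (Algebra.TensorProduct.map α β (Coalgebra.comul (R := k) D.y)) (v ⊗ₜ[k] w) = _
  rw [comul_y, map_add, map_add, LinearMap.add_apply, Algebra.TensorProduct.map_tmul,
    Algebra.TensorProduct.map_tmul, map_one]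
  rfl

theorem rep_tensorAct (h : G) :
    rep (FDMod.tensorAct α β) h = Representation.tprod (rep α) (rep β) h := by
  change Module.endTensorEndAlgHom (R := k) (S := k) (A := k)
    (Algebra.TensorProduct.map α β (Coalgebra.comul (R := k) (D.gr h))) = _
  rw [comul_gr, Algebra.TensorProduct.map_tmul]
  rfl

end Tensor

end GroupDatum

/-! ### Tensor identities for induced modules. -/

namespace GroupDatum

variable {k : Type u} [Field k] {G : Type v} [Group G] {D : GroupDatum k G}

section TensorInduced

variable {V W : Type u} [AddCommGroup V] [Module k V] [AddCommGroup W] [Module k W]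

theorem stringGrp_single (ρ : Representation k G V) (h : G) {j : ℕ} (i : Fin j) (v : V) :
    D.stringGrp ρ j h (Pi.single i v) =
      Pi.single i ((((D.χ h)⁻¹ ^ (i : ℕ) : kˣ) : k) • ρ h v) := by
  ext l
  rw [stringGrp_apply]
  by_cases hl : l = i
  · subst hl
    rw [Pi.single_eq_same, Pi.single_eq_same]
  · rw [Pi.single_eq_of_ne hl, Pi.single_eq_of_ne hl, map_zero, smul_zero]

theorem act_mem_range {α : D.H →ₐ[k] Module.End k V} {β : D.H →ₐ[k] Module.End k W}
    {f : V →ₗ[k] W} (hf : ∀ a m, f (α a m) = β a (f m)) (a : D.H) {w : W}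
    (hw : w ∈ LinearMap.range f) : β a w ∈ LinearMap.range f := by
  obtain ⟨m, rfl⟩ := hw
  exact ⟨_, hf a m⟩

variable [Finite G]

variable (D V) in
/-- The inclusion of `V` into the module induced from `V`. -/
noncomputable def inducedIncl : V →ₗ[k] (Fin D.n → V) :=
  LinearMap.single k (fun _ => V) ⟨0, Nat.pos_of_ne_zero D.n_ne_zero⟩

variable (hχ : D.χ ^ D.n = 1) (ρ : Representation k G V)

theorem rep_inducedIncl (h : G) (v : V) :
    rep (D.inducedAct hχ ρ) h (inducedIncl D V v) = inducedIncl D V (ρ h v) := by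
  change D.inducedAct hχ ρ (D.gr h) (Pi.single _ v) = Pi.single _ _
  rw [inducedAct_gr, stringGrp_single]
  simp

variable (α : D.H →ₐ[k] Module.End k W)

theorem lTensor_inducedIncl (h : G) (t : W ⊗[k] V) :
    (inducedIncl D V).lTensor W (Representation.tprod (rep α) ρ h t) =
      rep (FDMod.tensorAct α (D.inducedAct hχ ρ)) h ((inducedIncl D V).lTensor W t) := by
  rw [rep_tensorAct]
  induction t with
  | zero => simp
  | add s t hs ht => simp only [map_add, hs, ht]
  | tmul w v => simp [rep_inducedIncl]

theorem rTensor_inducedIncl (h : G) (t : V ⊗[k] W) :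
    (inducedIncl D V).rTensor W (Representation.tprod ρ (rep α) h t) =
      rep (FDMod.tensorAct (D.inducedAct hχ ρ) α) h ((inducedIncl D V).rTensor W t) := by
  rw [rep_tensorAct]
  induction t with
  | zero => simp
  | add s t hs ht => simp only [map_add, hs, ht]
  | tmul v w => simp [rep_inducedIncl]

/-- The image contains every `m ⊗ v`. Applying `y` to `m ⊗ xⁱv` gives `ym ⊗ g(xⁱv) + m ⊗ xⁱ⁺¹v`, and
the first term is of the kind already reached, so induction on `i` reaches every `m ⊗ xⁱv`. -/
theorem ofInduced_lTensor_surjective : Function.Surjective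
    (ofInduced (FDMod.tensorAct α (D.inducedAct hχ ρ)) ((inducedIncl D V).lTensor W)) := by
  set F := ofInduced (FDMod.tensorAct α (D.inducedAct hχ ρ)) ((inducedIncl D V).lTensor W)
  have hF := ofInduced_act hχ _ (FDMod.tensorAct α (D.inducedAct hχ ρ))
    ((inducedIncl D V).lTensor W) (lTensor_inducedIncl hχ ρ α)
  have hmem : ∀ i (hi : i < D.n) (m : W) (v : V),
      m ⊗ₜ[k] (Pi.single ⟨i, hi⟩ v : Fin D.n → V) ∈ LinearMap.range F := by
    intro i
    induction i with
    | zero => exact fun hi m v => ⟨_, ofInduced_single _ _ (m ⊗ₜ[k] v)⟩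
    | succ i ih =>
      intro hi m v
      have h1 := act_mem_range hF D.y (ih (by omega) m v)
      rw [tensorAct_y, inducedAct_y, wrapShift_single _ _ hi, rep_apply, inducedAct_gr,
        stringGrp_single] at h1
      exact (Submodule.add_mem_iff_right _ (ih _ _ _)).1 h1
  rw [← LinearMap.range_eq_top, eq_top_iff]
  intro t _
  induction t with
  | zero => exact zero_mem _
  | add s t hs ht => exact add_mem (hs trivial) (ht trivial)
  | tmul m f =>
    rw [← Finset.univ_sum_single f, TensorProduct.tmul_sum]
    exact sum_mem fun i _ => hmem i i.2 m (f i)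

theorem ofInduced_rTensor_surjective : Function.Surjective
    (ofInduced (FDMod.tensorAct (D.inducedAct hχ ρ) α) ((inducedIncl D V).rTensor W)) := by
  set F := ofInduced (FDMod.tensorAct (D.inducedAct hχ ρ) α) ((inducedIncl D V).rTensor W)
  have hF := ofInduced_act hχ _ (FDMod.tensorAct (D.inducedAct hχ ρ) α)
    ((inducedIncl D V).rTensor W) (rTensor_inducedIncl hχ ρ α)
  have hmem : ∀ i (hi : i < D.n) (m : W) (v : V),
      (Pi.single ⟨i, hi⟩ v : Fin D.n → V) ⊗ₜ[k] m ∈ LinearMap.range F := by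
    intro i
    induction i with
    | zero => exact fun hi m v => ⟨_, ofInduced_single _ _ (v ⊗ₜ[k] m)⟩
    | succ i ih =>
      intro hi m v
      -- Here `y` sends `xⁱv ⊗ m'` to `xⁱ⁺¹v ⊗ gm' + xⁱv ⊗ ym'`, so `m' = g⁻¹m` is the choice that
      -- produces `xⁱ⁺¹v ⊗ m`.
      have h1 := act_mem_range hF D.y (ih (by omega) (rep α D.g⁻¹ m) v)
      rw [tensorAct_y, inducedAct_y, wrapShift_single _ _ hi, ← Module.End.mul_apply (rep α D.g),
        ← map_mul, mul_inv_cancel, map_one, Module.End.one_apply] at h1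
      exact (Submodule.add_mem_iff_left _ (ih _ _ _)).1 h1
  rw [← LinearMap.range_eq_top, eq_top_iff]
  intro t _
  induction t with
  | zero => exact zero_mem _
  | add s t hs ht => exact add_mem (hs trivial) (ht trivial)
  | tmul f m =>
    rw [← Finset.univ_sum_single f, TensorProduct.sum_tmul]
    exact sum_mem fun i _ => hmem i i.2 m (f i)

end TensorInduced

section TensorInduced

variable [Finite G] {V : Type u} [AddCommGroup V] [Module k V] [FiniteDimensional k V]
  (hχ : D.χ ^ D.n = 1) (ρ : Representation k G V) (M : FDMod k D.H)

/-- The surjection above is bijective because both sides have dimension `n · dim M · dim V`. -/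
theorem induced_tensor_iso :
    (D.induced hχ (Representation.tprod (rep M.act) ρ)).Iso (M.tensor (D.induced hχ ρ)) := by
  have hs := ofInduced_lTensor_surjective hχ ρ M.act
  have hd : Module.finrank k (Fin D.n → M.carrier ⊗[k] V) =
      Module.finrank k (M.carrier ⊗[k] (Fin D.n → V)) := by
    rw [Module.finrank_tensorProduct, Module.finrank_pi_fintype, Module.finrank_pi_fintype]
    simp only [Module.finrank_tensorProduct, Finset.sum_const, smul_eq_mul]
    ring
  exact FDMod.IsHom.iso (ofInduced_act hχ _ (FDMod.tensorAct M.act (D.inducedAct hχ ρ))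
    ((inducedIncl D V).lTensor M.carrier) (lTensor_inducedIncl hχ ρ M.act))
    ⟨(LinearMap.injective_iff_surjective_of_finrank_eq_finrank hd).2 hs, hs⟩

theorem tensor_induced_iso :
    (D.induced hχ (Representation.tprod ρ (rep M.act))).Iso ((D.induced hχ ρ).tensor M) := by
  have hs := ofInduced_rTensor_surjective hχ ρ M.act
  have hd : Module.finrank k (Fin D.n → V ⊗[k] M.carrier) =
      Module.finrank k ((Fin D.n → V) ⊗[k] M.carrier) := by
    rw [Module.finrank_tensorProduct, Module.finrank_pi_fintype, Module.finrank_pi_fintype]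
    simp only [Module.finrank_tensorProduct, Finset.sum_const, smul_eq_mul]
    ring
  exact FDMod.IsHom.iso (ofInduced_act hχ _ (FDMod.tensorAct (D.inducedAct hχ ρ) M.act)
    ((inducedIncl D V).rTensor M.carrier) (rTensor_inducedIncl hχ ρ M.act))
    ⟨(LinearMap.injective_iff_surjective_of_finrank_eq_finrank hd).2 hs, hs⟩

end TensorInduced

/-! ### The ideal spanned by the projectives. -/

section Ideal

variable [Finite G] (hχ : D.χ ^ D.n = 1)

theorem isRetract_induced {M : FDMod k D.H} (hM : M.IsProjective) :
    M.IsRetract (D.induced hχ (rep M.act)) :=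
  hM.isRetract (ofInduced_act hχ (rep M.act) M.act LinearMap.id fun _ _ => rfl)
    fun m => ⟨_, ofInduced_single M.act LinearMap.id m⟩

variable [CharZero k]

theorem isProjective_induced {V : Type u} [AddCommGroup V] [Module k V] [FiniteDimensional k V]
    (ρ : Representation k G V) : (D.induced hχ ρ).IsProjective :=
  (HasTrace.induced hχ ρ).isProjective

include hχ in
theorem isProjective_of_isRetract {M N : FDMod k D.H} (hN : N.IsProjective) (h : M.IsRetract N) :
    M.IsProjective :=
  ((hasTrace_of_isProjective hχ hN).of_isRetract h).isProjective

include hχ in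
-- A projective `M` is a summand of an induced module, and `X` tensored with an induced module is
-- again induced.
theorem isProjective_tensor_left (X : FDMod k D.H) {M : FDMod k D.H} (hM : M.IsProjective) :
    (X.tensor M).IsProjective :=
  isProjective_of_isRetract hχ (isProjective_induced hχ _)
    (((isRetract_induced hχ hM).tensor_left X).trans (induced_tensor_iso hχ _ X).symm.isRetract)

include hχ in
theorem isProjective_tensor_right (X : FDMod k D.H) {M : FDMod k D.H} (hM : M.IsProjective) :
    (M.tensor X).IsProjective :=
  isProjective_of_isRetract hχ (isProjective_induced hχ _)
    (((isRetract_induced hχ hM).tensor_right X).trans (tensor_induced_iso hχ _ X).symm.isRetract)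

include hχ in
theorem cls_mem_closure_projIndec {M : FDMod k D.H} (hM : M.IsProjective) :
    GreenRing.cls M ∈ AddSubgroup.closure (GreenRing.projIndec k D.H) :=
  GreenRing.cls_mem_closure_indecomposable (Q := FDMod.IsProjective) (fun _ X Y hXY h =>
    ⟨isProjective_of_isRetract hχ h ((X.isRetract_sum_left Y).trans hXY.symm.isRetract),
      isProjective_of_isRetract hχ h ((X.isRetract_sum_right Y).trans hXY.symm.isRetract)⟩) M hM

include hχ in
theorem mul_mem_closure_projIndec (x : GreenRing k D.H) {p : GreenRing k D.H}
    (hp : p ∈ AddSubgroup.closure (GreenRing.projIndec k D.H)) :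
    x * p ∈ AddSubgroup.closure (GreenRing.projIndec k D.H) := by
  induction hp using AddSubgroup.closure_induction with
  | zero => rw [mul_zero]; exact zero_mem _
  | add p q _ _ hp hq => rw [mul_add]; exact add_mem hp hq
  | neg p _ hp => rw [mul_neg]; exact neg_mem hp
  | mem p hp =>
    obtain ⟨M, _, hM, rfl⟩ := hp
    induction x using GreenRing.induction with
    | zero => rw [zero_mul]; exact zero_mem _
    | neg x hx => rw [neg_mul]; exact neg_mem hx
    | add x y hx hy => rw [add_mul]; exact add_mem hx hy
    | cls X =>
      rw [← GreenRing.cls_tensor]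
      exact cls_mem_closure_projIndec hχ (isProjective_tensor_left hχ X hM)

include hχ in
theorem mul_mem_closure_projIndec' (x : GreenRing k D.H) {p : GreenRing k D.H}
    (hp : p ∈ AddSubgroup.closure (GreenRing.projIndec k D.H)) :
    p * x ∈ AddSubgroup.closure (GreenRing.projIndec k D.H) := by
  induction hp using AddSubgroup.closure_induction with
  | zero => rw [zero_mul]; exact zero_mem _
  | add p q _ _ hp hq => rw [add_mul]; exact add_mem hp hq
  | neg p _ hp => rw [neg_mul]; exact neg_mem hp
  | mem p hp =>
    obtain ⟨M, _, hM, rfl⟩ := hp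
    induction x using GreenRing.induction with
    | zero => rw [mul_zero]; exact zero_mem _
    | neg x hx => rw [mul_neg]; exact neg_mem hx
    | add x y hx hy => rw [mul_add]; exact add_mem hx hy
    | cls X =>
      rw [← GreenRing.cls_tensor]
      exact cls_mem_closure_projIndec hχ (isProjective_tensor_right hχ X hM)

include hχ in
-- The span already absorbs products: a tensor product with a projective factor is projective and
-- decomposes into indecomposable projectives.
theorem coe_projIdeal : (GreenRing.projIdeal k D.H : Set (GreenRing k D.H)) =
    AddSubgroup.closure (GreenRing.projIndec k D.H) := by
  let I : TwoSidedIdeal (GreenRing k D.H) :=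
    TwoSidedIdeal.mk' (AddSubgroup.closure (GreenRing.projIndec k D.H)) (zero_mem _)
      (fun h h' => add_mem h h') (fun h => neg_mem h)
      (fun hy => mul_mem_closure_projIndec hχ _ hy) (fun hx => mul_mem_closure_projIndec' hχ _ hx)
  have hI : (I : Set (GreenRing k D.H)) = AddSubgroup.closure (GreenRing.projIndec k D.H) :=
    TwoSidedIdeal.coe_mk' _ _ _ _ _ _
  refine Set.Subset.antisymm ?_ ?_
  · rw [← hI]
    refine TwoSidedIdeal.le_iff.1 (TwoSidedIdeal.span_le.2 ?_)
    rw [hI]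
    exact AddSubgroup.subset_closure
  · intro x hx
    induction hx using AddSubgroup.closure_induction with
    | mem x hx => exact TwoSidedIdeal.subset_span hx
    | zero => exact TwoSidedIdeal.zero_mem _
    | add x y _ _ hx hy => exact TwoSidedIdeal.add_mem _ hx hy
    | neg x _ hx => exact TwoSidedIdeal.neg_mem _ hx

end Ideal

end GroupDatum

namespace GroupDatum

variable {k : Type u} [Field k] {G : Type v} [Group G] {D : GroupDatum k G}

/-! ### Modules on which `gⁿ` is trivial, as modules over `H̄`. -/

section Descend

variable {V W : Type*} [AddCommGroup V] [Module k V] [AddCommGroup W] [Module k W]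

/-- `gⁿ` is central in `G` and commutes with `y` since `χ(gⁿ) = 1`. Hence the kernel and the image
of `gⁿ - 1` are submodules. -/
theorem gr_pow_mul (a : D.H) : D.gr (D.g ^ D.n) * a = a * D.gr (D.g ^ D.n) := by
  refine induction (P := fun a => D.gr (D.g ^ D.n) * a = a * D.gr (D.g ^ D.n)) ?_ ?_ ?_ ?_ ?_ a
  · exact fun c => (Algebra.commutes c _).symm
  · rw [y_mul, χ_g_pow_n, Units.val_one, one_smul]
  · intro h
    rw [← map_mul, ← map_mul, Subgroup.mem_center_iff.1 D.pow_mem_center h]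
  · intro a b ha hb
    rw [← mul_assoc, ha, mul_assoc, hb, mul_assoc]
  · intro a b ha hb
    rw [mul_add, ha, hb, add_mul]

theorem projAlgHom_surjective : Function.Surjective D.projAlgHom := by
  refine induction (P := fun b => ∃ a, D.projAlgHom a = b) ?_ ?_ ?_ ?_ ?_
  · exact fun c => ⟨algebraMap k D.H c, D.projAlgHom.commutes c⟩
  · exact ⟨_, D.projAlgHom_y⟩
  · intro x
    obtain ⟨h, rfl⟩ := QuotientGroup.mk'_surjective D.N x
    exact ⟨_, D.projAlgHom_gr h⟩
  · rintro _ _ ⟨a, rfl⟩ ⟨b, rfl⟩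
    exact ⟨_, map_mul _ a b⟩
  · rintro _ _ ⟨a, rfl⟩ ⟨b, rfl⟩
    exact ⟨_, map_add _ a b⟩

/-- An `H`-module on which `gⁿ` acts as the identity is an `H̄`-module. -/
noncomputable def descend (α : D.H →ₐ[k] Module.End k V) (hα : rep α (D.g ^ D.n) = 1) :
    D.bar.H →ₐ[k] Module.End k V :=
  D.bar.lift (QuotientGroup.lift D.N (rep α) (D.map_eq_one (rep α) hα)) (α D.y)
    (by
      change α D.y ^ D.n = (0 : k) • _
      rw [zero_smul]
      refine LinearMap.ext fun m => ?_
      rw [act_y_pow_n, hα]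
      simp)
    (by
      intro x
      obtain ⟨h, rfl⟩ := QuotientGroup.mk'_surjective D.N x
      change α D.y * α (D.gr h) = (D.χ h : k) • (α (D.gr h) * α D.y)
      rw [← map_mul, y_mul, map_smul, map_mul])

theorem descend_comp (α : D.H →ₐ[k] Module.End k V) (hα : rep α (D.g ^ D.n) = 1) :
    (descend α hα).comp D.projAlgHom = α := by
  refine algHom_ext ?_ fun h => ?_
  · rw [AlgHom.comp_apply, projAlgHom_y]
    exact lift_y
  · rw [AlgHom.comp_apply, projAlgHom_gr]
    exact lift_gr _

theorem descend_proj (α : D.H →ₐ[k] Module.End k V) (hα : rep α (D.g ^ D.n) = 1) (a : D.H) :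
    descend α hα (D.projAlgHom a) = α a :=
  DFunLike.congr_fun (descend_comp α hα) a

theorem rep_comp_proj (β : D.bar.H →ₐ[k] Module.End k V) :
    rep (β.comp D.projAlgHom) (D.g ^ D.n) = 1 := by
  rw [rep_apply, AlgHom.comp_apply, projAlgHom_gr]
  have h : QuotientGroup.mk' D.N (D.g ^ D.n) = 1 := D.bar_g_pow_n
  rw [h, map_one, map_one]

theorem isHom_of_proj {X Y : FDMod k D.bar.H} {f : X.carrier →ₗ[k] Y.carrier}
    (hf : ∀ a m, f (X.act (D.projAlgHom a) m) = Y.act (D.projAlgHom a) (f m)) : X.IsHom Y f := by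
  intro b
  obtain ⟨a, rfl⟩ := projAlgHom_surjective b
  exact hf a

end Descend

/-! ### Splitting a module by the action of `gⁿ`. -/

section FixedPart

/-- The vectors fixed by `gⁿ`. -/
noncomputable def fixedSubmodule (M : FDMod k D.H) : Submodule k M.carrier :=
  LinearMap.ker (rep M.act (D.g ^ D.n) - 1)

/-- The image of `gⁿ - 1`. -/
noncomputable def movedSubmodule (M : FDMod k D.H) : Submodule k M.carrier :=
  LinearMap.range (rep M.act (D.g ^ D.n) - 1)

theorem mem_fixedSubmodule {M : FDMod k D.H} {m : M.carrier} :
    m ∈ fixedSubmodule M ↔ rep M.act (D.g ^ D.n) m = m := by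
  rw [fixedSubmodule, LinearMap.mem_ker, LinearMap.sub_apply, Module.End.one_apply, sub_eq_zero]

theorem rep_pow_act (M : FDMod k D.H) (a : D.H) (m : M.carrier) :
    rep M.act (D.g ^ D.n) (M.act a m) = M.act a (rep M.act (D.g ^ D.n) m) := by
  rw [rep_apply, ← Module.End.mul_apply, ← map_mul, gr_pow_mul, map_mul, Module.End.mul_apply]

theorem act_mem_fixedSubmodule (M : FDMod k D.H) (a : D.H) :
    ∀ m ∈ fixedSubmodule M, M.act a m ∈ fixedSubmodule M := by
  intro m hm
  rw [mem_fixedSubmodule] at hm ⊢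
  rw [rep_pow_act, hm]

theorem act_mem_movedSubmodule (M : FDMod k D.H) (a : D.H) :
    ∀ m ∈ movedSubmodule M, M.act a m ∈ movedSubmodule M := by
  rintro _ ⟨m, rfl⟩
  refine ⟨M.act a m, ?_⟩
  rw [LinearMap.sub_apply, LinearMap.sub_apply, rep_pow_act, map_sub]
  rfl

/-- The `H`-module of vectors fixed by `gⁿ`. -/
noncomputable def fixedSub (M : FDMod k D.H) : FDMod k D.H :=
  M.sub (fixedSubmodule M) (act_mem_fixedSubmodule M)

/-- The complement of the module of vectors fixed by `gⁿ`. -/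
noncomputable def movedSub (M : FDMod k D.H) : FDMod k D.H :=
  M.sub (movedSubmodule M) (act_mem_movedSubmodule M)

theorem rep_fixedSub (M : FDMod k D.H) : rep (fixedSub M).act (D.g ^ D.n) = 1 :=
  LinearMap.ext fun m : fixedSubmodule M => Subtype.ext (mem_fixedSubmodule.1 m.2)

/-- The `H̄`-module of vectors fixed by `gⁿ`. -/
noncomputable def fixedPart (M : FDMod k D.H) : FDMod k D.bar.H where
  carrier := (fixedSub M).carrier
  act := descend (fixedSub M).act (rep_fixedSub M)

theorem fixedPart_act_proj (M : FDMod k D.H) (a : D.H) :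
    (fixedPart M).act (D.projAlgHom a) = (fixedSub M).act a :=
  descend_proj (fixedSub M).act (rep_fixedSub M) a

theorem restrict_fixedPart (M : FDMod k D.H) :
    ((fixedPart M).restrict D.projAlgHom).Iso (fixedSub M) :=
  ⟨LinearEquiv.refl k _, fun a m => LinearMap.congr_fun (fixedPart_act_proj M a) m⟩

theorem map_mem_fixedSubmodule {M N : FDMod k D.H} {f : M.carrier →ₗ[k] N.carrier}
    (hf : M.IsHom N f) : ∀ m ∈ fixedSubmodule M, f m ∈ fixedSubmodule N := by
  intro m hm
  rw [mem_fixedSubmodule] at hm ⊢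
  rw [rep_apply, ← hf, ← rep_apply, hm]

/-- A homomorphism of `H`-modules restricts to the vectors fixed by `gⁿ`. -/
noncomputable def fixedMap {M N : FDMod k D.H} {f : M.carrier →ₗ[k] N.carrier}
    (hf : M.IsHom N f) : fixedSubmodule M →ₗ[k] fixedSubmodule N :=
  f.restrict (map_mem_fixedSubmodule hf)

theorem fixedMap_isHom {M N : FDMod k D.H} {f : M.carrier →ₗ[k] N.carrier}
    (hf : M.IsHom N f) : (fixedPart M).IsHom (fixedPart N) (fixedMap hf) := by
  refine isHom_of_proj fun a (m : fixedSubmodule M) => ?_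
  rw [fixedPart_act_proj, fixedPart_act_proj]
  exact Subtype.ext (hf a m)

theorem fixedPart_congr {M N : FDMod k D.H} (h : M.Iso N) :
    (fixedPart M).Iso (fixedPart N) := by
  obtain ⟨e, he⟩ := h
  have hf : M.IsHom N e.toLinearMap := he
  refine (fixedMap_isHom hf).iso ⟨fun x y hxy => ?_, fun (y : fixedSubmodule N) => ?_⟩
  · exact Subtype.ext (e.injective (congrArg Subtype.val hxy))
  · refine ⟨⟨e.symm y.1, ?_⟩, Subtype.ext (e.apply_symm_apply _)⟩
    have hy := mem_fixedSubmodule.1 y.2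
    rw [mem_fixedSubmodule, LinearEquiv.eq_symm_apply, rep_apply, he, LinearEquiv.apply_symm_apply]
    exact hy

theorem fst_isHom (M N : FDMod k D.H) :
    (M.sum N).IsHom M (LinearMap.fst k M.carrier N.carrier) := fun _ _ => rfl

theorem snd_isHom (M N : FDMod k D.H) :
    (M.sum N).IsHom N (LinearMap.snd k M.carrier N.carrier) := fun _ _ => rfl

theorem fixedPart_sum (M N : FDMod k D.H) :
    (fixedPart (M.sum N)).Iso ((fixedPart M).sum (fixedPart N)) := by
  let f : fixedSubmodule (M.sum N) →ₗ[k] fixedSubmodule M × fixedSubmodule N :=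
    (fixedMap (fst_isHom M N)).prod (fixedMap (snd_isHom M N))
  have hf : (fixedPart (M.sum N)).IsHom ((fixedPart M).sum (fixedPart N)) f := fun a m =>
    Prod.ext (fixedMap_isHom (fst_isHom M N) a m) (fixedMap_isHom (snd_isHom M N) a m)
  refine hf.iso ⟨fun x y hxy => ?_, fun p => ?_⟩
  · exact Subtype.ext (Prod.ext (congrArg (fun q => q.1.1) hxy) (congrArg (fun q => q.2.1) hxy))
  · refine ⟨⟨(p.1.1, p.2.1), mem_fixedSubmodule.2 ?_⟩, rfl⟩
    exact Prod.ext (mem_fixedSubmodule.1 p.1.2) (mem_fixedSubmodule.1 p.2.2)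

theorem fixedPart_restrict (X : FDMod k D.bar.H) :
    (fixedPart (X.restrict D.projAlgHom)).Iso X := by
  let f : fixedSubmodule (X.restrict D.projAlgHom) →ₗ[k] X.carrier :=
    (fixedSubmodule (X.restrict D.projAlgHom)).subtype
  have hf : (fixedPart (X.restrict D.projAlgHom)).IsHom X f := by
    refine isHom_of_proj fun a m => ?_
    rw [fixedPart_act_proj]
    rfl
  refine hf.iso ⟨Subtype.val_injective, fun x => ⟨⟨x, ?_⟩, rfl⟩⟩
  exact mem_fixedSubmodule.2 (LinearMap.congr_fun (rep_comp_proj X.act) x)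

/-- Let `T` be the action of `gⁿ`. If `x = Tz - z` is fixed by `T`, then `Tʲz = z + jx` for all `j`;
for `j = |G|` the left side is `z`, so `|G|x = 0`. -/
theorem disjoint_fixed_moved [CharZero k] [Finite G] (M : FDMod k D.H) :
    Disjoint (fixedSubmodule M) (movedSubmodule M) := by
  rw [Submodule.disjoint_def]
  rintro _ hx ⟨z, rfl⟩
  set T := rep M.act (D.g ^ D.n) with hT
  rw [mem_fixedSubmodule, ← hT] at hx
  set x := (T - 1) z with hxz
  have hTz : T z = z + x := by rw [hxz, LinearMap.sub_apply, Module.End.one_apply]; abel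
  have hpow : ∀ j : ℕ, (T ^ j) z = z + (j : k) • x := by
    intro j
    induction j with
    | zero => simp
    | succ j ih =>
      rw [pow_succ', Module.End.mul_apply, ih, map_add, map_smul, hx, hTz, Nat.cast_succ, add_smul,
        one_smul]
      abel
  have h1 := hpow (Nat.card G)
  rw [hT, ← map_pow, pow_card_eq_one', map_one, Module.End.one_apply, left_eq_add] at h1
  exact (smul_eq_zero.1 h1).resolve_left (Nat.cast_ne_zero.2 Nat.card_pos.ne')

theorem isCompl_fixed_moved [CharZero k] [Finite G] (M : FDMod k D.H) :
    IsCompl (fixedSubmodule M) (movedSubmodule M) := by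
  refine ⟨disjoint_fixed_moved M, codisjoint_iff.2 ?_⟩
  refine Submodule.eq_top_of_disjoint _ _ ?_ (disjoint_fixed_moved M)
  rw [add_comm]
  exact (LinearMap.finrank_range_add_finrank_ker _).ge

/-- As `yⁿ = μ(gⁿ - 1)` is injective, `yⁿ⁻¹` is invertible. With `t = (1/n) y⁻⁽ⁿ⁻¹⁾`, each of the
`n` terms `yⁱ t yⁿ⁻¹⁻ⁱ` is `1/n`, and `t` has the right twist because it inverts `yⁿ⁻¹`. -/
theorem hasTrace_of_fixed_eq_zero [CharZero k] [Finite G] (hμ : D.μ ≠ 0) (M : FDMod k D.H)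
    (hM : ∀ m, rep M.act (D.g ^ D.n) m = m → m = 0) : HasTrace M := by
  have hn : D.n = D.n - 1 + 1 := by have := D.n_ne_zero; omega
  have hinj : Function.Injective (M.act D.y ^ (D.n - 1)) := by
    refine (injective_iff_map_eq_zero _).2 fun m hm => hM m (sub_eq_zero.1 ?_)
    have h1 := act_y_pow_n M.act m
    rw [hn, pow_succ', Module.End.mul_apply, hm, map_zero, ← hn] at h1
    exact (smul_eq_zero.1 h1.symm).resolve_left hμ
  let e := LinearEquiv.ofBijective (M.act D.y ^ (D.n - 1))
    ⟨hinj, LinearMap.injective_iff_surjective.1 hinj⟩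
  have he : ∀ z, e.symm ((M.act D.y ^ (D.n - 1)) z) = z := e.symm_apply_apply
  refine ⟨(D.n : k)⁻¹ • e.symm.toLinearMap, fun h m => ?_, fun m => ?_⟩
  · obtain ⟨z, rfl⟩ := e.surjective m
    change rep M.act h ((D.n : k)⁻¹ • e.symm (e z)) = _ • (D.n : k)⁻¹ •
      e.symm (M.act (D.gr h) ((M.act D.y ^ (D.n - 1)) z))
    rw [e.symm_apply_apply, map_smul, act_gr_y_pow, map_smul, he, smul_comm,
      smul_smul ((D.χ h ^ (D.n - 1) : kˣ) : k), ← Units.val_mul, inv_pow, mul_inv_cancel,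
      Units.val_one, one_smul]
    rfl
  · obtain ⟨z, rfl⟩ := e.surjective m
    have h1 : ∀ i ∈ Finset.range D.n, (M.act D.y ^ i) (((D.n : k)⁻¹ • e.symm.toLinearMap)
        ((M.act D.y ^ (D.n - 1 - i)) (e z))) = (D.n : k)⁻¹ • e z := by
      intro i hi
      have := Finset.mem_range.1 hi
      change (M.act D.y ^ i) ((D.n : k)⁻¹ • e.symm ((M.act D.y ^ (D.n - 1 - i))
        ((M.act D.y ^ (D.n - 1)) z))) = (D.n : k)⁻¹ • (M.act D.y ^ (D.n - 1)) z
      rw [← Module.End.mul_apply (M.act D.y ^ (D.n - 1 - i)), ← pow_add, add_comm, pow_add,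
        Module.End.mul_apply, he, map_smul, ← Module.End.mul_apply, ← pow_add,
        show i + (D.n - 1 - i) = D.n - 1 by omega]
    rw [Finset.sum_congr rfl h1, Finset.sum_const, Finset.card_range, ← Nat.cast_smul_eq_nsmul k,
      smul_smul, mul_inv_cancel₀ (Nat.cast_ne_zero.2 D.n_ne_zero), one_smul]

theorem isProjective_movedSub [CharZero k] [Finite G] (hμ : D.μ ≠ 0) (M : FDMod k D.H) :
    (movedSub M).IsProjective := by
  refine (hasTrace_of_fixed_eq_zero hμ _ fun (m : movedSubmodule M) hm => ?_).isProjective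
  have h1 : rep M.act (D.g ^ D.n) m = m := congrArg Subtype.val hm
  exact Subtype.ext (Submodule.disjoint_def.1 (disjoint_fixed_moved M) _
    (mem_fixedSubmodule.2 h1) m.2)

theorem iso_fixedSub_sum_movedSub [CharZero k] [Finite G] (M : FDMod k D.H) :
    M.Iso ((fixedSub M).sum (movedSub M)) :=
  M.iso_sum_of_isCompl (isCompl_fixed_moved M) _ _

variable [Finite G]

variable (D) in
/-- The homomorphism of additive groups `r(H) → r(H̄)` that takes the class of a module to the
class of its submodule of vectors fixed by `gⁿ`. -/
noncomputable def fixedGreen : GreenRing k D.H →+ GreenRing k D.bar.H :=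
  GreenRing.liftAdd (fun M => GreenRing.cls (fixedPart M))
    (fun _ _ h => GreenRing.cls_congr (fixedPart_congr h))
    (fun M N => (GreenRing.cls_congr (fixedPart_sum M N)).trans (GreenRing.cls_sum _ _))

theorem fixedGreen_cls (M : FDMod k D.H) :
    fixedGreen D (GreenRing.cls M) = GreenRing.cls (fixedPart M) :=
  GreenRing.liftAdd_cls _ _ _ M

theorem restrict_proj_cls (X : FDMod k D.bar.H) : GreenRing.restrict D.proj (GreenRing.cls X) =
    GreenRing.cls (X.restrict D.projAlgHom) :=
  GreenRing.restrict_cls D.proj X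

theorem fixedGreen_restrict (x : GreenRing k D.bar.H) :
    fixedGreen D (GreenRing.restrict D.proj x) = x := by
  induction x using GreenRing.induction with
  | zero => rw [map_zero, map_zero]
  | neg x hx => rw [map_neg, map_neg, hx]
  | add x y hx hy => rw [map_add, map_add, hx, hy]
  | cls X =>
    rw [restrict_proj_cls, fixedGreen_cls]
    exact GreenRing.cls_congr (fixedPart_restrict X)

theorem cls_eq_restrict_add [CharZero k] (M : FDMod k D.H) : GreenRing.cls M =
    GreenRing.restrict D.proj (fixedGreen D (GreenRing.cls M)) + GreenRing.cls (movedSub M) := by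
  rw [fixedGreen_cls, restrict_proj_cls, GreenRing.cls_congr (restrict_fixedPart M),
    ← GreenRing.cls_sum]
  exact GreenRing.cls_congr (iso_fixedSub_sum_movedSub M)

end FixedPart

end GroupDatum

/-! ### The ring homomorphism from `R ⊕ P` to `S`. -/

namespace TrivialExt

variable {R : Type u} {S : Type v} [Ring R] [Ring S] (f : R →+* S) (P : TwoSidedIdeal S)

/-- The ring homomorphism `(b, c) ↦ f b + c`. -/
def toRing : TrivialExt f P →+* S where
  toFun x := f x.fst + x.snd
  map_one' := by rw [fst_one, snd_one, map_one, add_zero]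
  map_zero' := by rw [fst_zero, snd_zero, map_zero, add_zero]
  map_add' x y := by rw [fst_add, snd_add, map_add, add_add_add_comm]
  map_mul' x y := by rw [fst_mul, snd_mul, map_mul]; noncomm_ring

theorem toRing_apply (x : TrivialExt f P) : toRing f P x = f x.fst + x.snd := rfl

end TrivialExt

namespace GroupDatum

variable {k : Type u} [Field k] {G : Type v} [Group G] {D : GroupDatum k G}

/-! ### Induction preserves direct sums. -/

section InducedSum

variable {V W : Type u} [AddCommGroup V] [Module k V] [AddCommGroup W] [Module k W]
  (hχ : D.χ ^ D.n = 1)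

theorem compLeft_inducedAct {ρ : Representation k G V} {σ : Representation k G W} (φ : V →ₗ[k] W)
    (hφ : ∀ h v, φ (ρ h v) = σ h (φ v)) : ∀ a f, φ.compLeft (Fin D.n) (D.inducedAct hχ ρ a f) =
      D.inducedAct hχ σ a (φ.compLeft (Fin D.n) f) := by
  refine map_act_of_generators (fun f => ?_) (fun h f => ?_)
  · rw [inducedAct_y, inducedAct_y]
    ext i
    rw [LinearMap.compLeft_apply, Function.comp_apply, wrapShift_apply, wrapShift_apply]
    split_ifs
    -- Without `map_pow` the operator stays in the form `ρ (gⁿ)`, to which `hφ` applies.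
    · simp [hφ, -map_pow]
    · rfl
  · rw [inducedAct_gr, inducedAct_gr]
    ext i
    rw [LinearMap.compLeft_apply, Function.comp_apply, stringGrp_apply, stringGrp_apply, map_smul,
      hφ]
    rfl

theorem induced_iso_sum [FiniteDimensional k V] (ρ : Representation k G V)
    (a b : Subrepresentation ρ) (h : IsCompl a.toSubmodule b.toSubmodule) :
    (D.induced hχ ρ).Iso ((D.induced hχ a.toRepresentation).sum
      (D.induced hχ b.toRepresentation)) := by
  refine FDMod.Iso.symm ?_
  let F : (Fin D.n → a.toSubmodule) × (Fin D.n → b.toSubmodule) →ₗ[k] (Fin D.n → V) :=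
    (a.toSubmodule.subtype.compLeft _).coprod (b.toSubmodule.subtype.compLeft _)
  have hF : ((D.induced hχ a.toRepresentation).sum (D.induced hχ b.toRepresentation)).IsHom
      (D.induced hχ ρ) F := by
    intro c p
    refine (congrArg₂ (· + ·)
      (compLeft_inducedAct hχ (σ := ρ) a.toSubmodule.subtype (fun _ _ => rfl) c p.1)
      (compLeft_inducedAct hχ (σ := ρ) b.toSubmodule.subtype (fun _ _ => rfl) c p.2)).trans ?_
    exact (map_add (D.inducedAct hχ ρ c) _ _).symm
  let e := Submodule.prodEquivOfIsCompl _ _ h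
  refine hF.iso ⟨fun p q hpq => ?_, fun (f : Fin D.n → V) => ?_⟩
  · have h1 : ∀ i, ((p.1 : Fin D.n → a.toSubmodule) i, (p.2 : Fin D.n → b.toSubmodule) i) =
        ((q.1 : Fin D.n → a.toSubmodule) i, (q.2 : Fin D.n → b.toSubmodule) i) :=
      fun i => e.injective (congrFun hpq i)
    exact Prod.ext (funext fun i => congrArg Prod.fst (h1 i))
      (funext fun i => congrArg Prod.snd (h1 i))
  · refine ⟨(fun i => (e.symm (f i)).1, fun i => (e.symm (f i)).2), funext fun i => ?_⟩
    exact e.apply_symm_apply (f i)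

end InducedSum

/-! ### Indecomposable projectives on which `gⁿ` is trivial. -/

section Structure

theorem rep_mem_range_y {V : Type*} [AddCommGroup V] [Module k V]
    (α : D.H →ₐ[k] Module.End k V) (h : G) :
    ∀ v ∈ LinearMap.range (α D.y), rep α h v ∈ LinearMap.range (α D.y) := by
  rintro _ ⟨v, rfl⟩
  refine ⟨(((D.χ h)⁻¹ : kˣ) : k) • rep α h v, ?_⟩
  have h1 := act_gr_y_pow α h 1 v
  rw [pow_one, pow_one] at h1
  rw [map_smul]
  exact h1.symm

/-- Nakayama's lemma for the nilpotent operator `y`: if `φ(W)` spans `V` modulo `yV`, then `V` is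
the image plus `yʲV` for every `j`, and `yⁿV = 0`. -/
theorem ofInduced_surjective [Finite G] {V W : Type u} [AddCommGroup V] [Module k V]
    [AddCommGroup W] [Module k W] (hχ : D.χ ^ D.n = 1) (ρ : Representation k G W)
    {α : D.H →ₐ[k] Module.End k V} (hα : α D.y ^ D.n = 0) (φ : W →ₗ[k] V)
    (hφ : ∀ h w, φ (ρ h w) = rep α h (φ w))
    (hs : LinearMap.range φ ⊔ LinearMap.range (α D.y) = ⊤) :
    Function.Surjective (ofInduced α φ) := by
  have hF := ofInduced_act hχ ρ α φ hφ
  have key : ∀ (j : ℕ) (v : V), ∃ r ∈ LinearMap.range (ofInduced α φ), ∃ w,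
      v = r + (α D.y ^ j) w := by
    intro j
    induction j with
    | zero => exact fun v => ⟨0, zero_mem _, v, by simp⟩
    | succ j ih =>
      intro v
      obtain ⟨_, ⟨x, rfl⟩, _, ⟨z, rfl⟩, hv⟩ := Submodule.mem_sup.1
        (show v ∈ LinearMap.range φ ⊔ LinearMap.range (α D.y) from hs ▸ Submodule.mem_top)
      obtain ⟨r, hr, w, hw⟩ := ih z
      refine ⟨φ x + α D.y r, add_mem ⟨_, ofInduced_single α φ x⟩ (act_mem_range hF D.y hr), w, ?_⟩
      rw [← hv, hw, map_add, ← add_assoc, pow_succ']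
      rfl
  intro v
  obtain ⟨r, hr, w, hw⟩ := key D.n v
  rw [hα, LinearMap.zero_apply, add_zero] at hw
  rw [hw]
  exact hr

/-- In a relation `∑ yⁱφ(fᵢ) = 0` whose terms below `j` vanish, applying `yⁿ⁻¹⁻ʲ` kills the terms
above `j` as well and leaves `yⁿ⁻¹φ(fⱼ) = 0`. -/
theorem ofInduced_injective {V W : Type u} [AddCommGroup V] [Module k V] [AddCommGroup W]
    [Module k W] {α : D.H →ₐ[k] Module.End k V} (hα : α D.y ^ D.n = 0) (φ : W →ₗ[k] V)
    (hφ : ∀ w, (α D.y ^ (D.n - 1)) (φ w) = 0 → w = 0) :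
    Function.Injective (ofInduced α φ) := by
  refine (injective_iff_map_eq_zero _).2 fun f hf => ?_
  rw [ofInduced_apply] at hf
  have key : ∀ (j : ℕ) (hj : j < D.n), f ⟨j, hj⟩ = 0 := by
    intro j
    induction j using Nat.strong_induction_on with
    | _ j ih =>
      intro hj
      have h1 := congrArg (α D.y ^ (D.n - 1 - j)) hf
      rw [map_sum, map_zero, Finset.sum_eq_single ⟨j, hj⟩] at h1
      · rw [← Module.End.mul_apply, ← pow_add, show D.n - 1 - j + j = D.n - 1 by omega] at h1
        exact hφ _ h1
      · intro i _ hi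
        have hi' : (i : ℕ) ≠ j := fun h => hi (Fin.ext h)
        by_cases hij : (i : ℕ) < j
        · rw [ih i hij i.2, map_zero, map_zero, map_zero]
        · rw [← Module.End.mul_apply, ← pow_add,
            show D.n - 1 - j + i = (i - j - 1) + D.n by omega, pow_add, hα, mul_zero,
            LinearMap.zero_apply]
      · simp
  exact funext fun i => key i i.2

/-- Take for `U` a `G`-stable complement of `yM`. It generates `M` because `y` is nilpotent, and it
generates freely because `yⁿ⁻¹` is injective on `U`, which is where projectivity enters through the
trace. -/
theorem exists_iso_induced [CharZero k] [Finite G] (hχ : D.χ ^ D.n = 1) {M : FDMod k D.H}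
    (hM : M.IsProjective) (hγ : rep M.act (D.g ^ D.n) = 1) :
    ∃ U : Subrepresentation (rep M.act), M.Iso (D.induced hχ U.toRepresentation) := by
  obtain ⟨U, hU, hU'⟩ := (rep M.act).exists_isCompl _ (rep_mem_range_y M.act)
  have hα : M.act D.y ^ D.n = 0 := by
    refine LinearMap.ext fun m => ?_
    rw [act_y_pow_n, hγ]
    simp
  refine ⟨⟨U, hU'⟩, FDMod.Iso.symm ?_⟩
  have hφ : ∀ (h : G) (w : U), U.subtype
      ((⟨U, hU'⟩ : Subrepresentation (rep M.act)).toRepresentation h w) =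
      rep M.act h (U.subtype w) := fun _ _ => rfl
  refine FDMod.IsHom.iso (ofInduced_act hχ _ M.act U.subtype hφ) ⟨?_, ?_⟩
  · refine ofInduced_injective hα U.subtype fun w hw => ?_
    obtain ⟨t, _, ht⟩ := hasTrace_of_isProjective hχ hM
    refine Subtype.ext (Submodule.disjoint_def.1 hU.disjoint _ ?_ w.2)
    -- In `w = ∑ yⁱ t yⁿ⁻¹⁻ⁱ w` the term `i = 0` vanishes since `yⁿ⁻¹w = 0`, and the others lie in
    -- `yM`. So `w` lies in both `U` and `yM`.
    rw [← ht w]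
    refine sum_mem fun i _ => ?_
    rcases i with _ | i
    · rw [Nat.sub_zero]
      have hw' : (M.act D.y ^ (D.n - 1)) (w : M.carrier) = 0 := hw
      rw [hw', map_zero, map_zero]
      exact zero_mem _
    · rw [pow_succ', Module.End.mul_apply]
      exact ⟨_, rfl⟩
  · refine ofInduced_surjective hχ _ hα U.subtype hφ ?_
    rw [Submodule.range_subtype, sup_comm]
    exact hU.sup_eq_top

theorem subsingleton_of_subsingleton_fun [Finite G] {V : Type*} (h : Subsingleton (Fin D.n → V)) :
    Subsingleton V :=
  ⟨fun x y => congrFun (h.elim (fun _ => x) fun _ => y) ⟨0, Nat.pos_of_ne_zero D.n_ne_zero⟩⟩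

/-- A `G`-stable subspace has a `G`-stable complement, and inducing both splits `M`; one of the two
summands must be zero. -/
theorem isIrreducible_of_isIndecomposable [CharZero k] [Finite G] (hχ : D.χ ^ D.n = 1)
    {V : Type u} [AddCommGroup V] [Module k V] [FiniteDimensional k V] (ρ : Representation k G V)
    {M : FDMod k D.H} (hM : M.IsIndecomposable) (h : M.Iso (D.induced hχ ρ)) :
    ρ.IsIrreducible := by
  have hV : Nontrivial V := by
    by_contra hV
    have hV' := not_nontrivial_iff_subsingleton.1 hV
    obtain ⟨e, _⟩ := h
    have h1 : Subsingleton (D.induced hχ ρ).carrier :=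
      inferInstanceAs (Subsingleton (Fin D.n → V))
    exact not_subsingleton_iff_nontrivial.2 hM.1 e.toEquiv.subsingleton
  have hne : (⊥ : Subrepresentation ρ) ≠ ⊤ := fun hbt =>
    bot_ne_top (α := Submodule k V) (congrArg Subrepresentation.toSubmodule hbt)
  have : Nontrivial (Subrepresentation ρ) := ⟨_, _, hne⟩
  refine ⟨fun a => ?_⟩
  obtain ⟨W, hW, hW'⟩ := ρ.exists_isCompl a.toSubmodule a.apply_mem_toSubmodule
  rcases hM.2 _ _ (h.trans (induced_iso_sum hχ ρ a ⟨W, hW'⟩ hW)) with hs | hs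
  · left
    have := subsingleton_of_subsingleton_fun (D := D) hs
    exact Subrepresentation.toSubmodule_injective ((Submodule.subsingleton_iff_eq_bot).1 this)
  · right
    have := subsingleton_of_subsingleton_fun (D := D) hs
    have hb : W = ⊥ := (Submodule.subsingleton_iff_eq_bot).1 this
    rw [hb] at hW
    exact Subrepresentation.toSubmodule_injective
      ((sup_bot_eq _).symm.trans hW.sup_eq_top)

/-- When `gⁿ` acts trivially the wrapping map `μ(gⁿ - 1)` is zero, so the cyclic shift becomes the
nilpotent one. -/
theorem induced_iso_stringModule {V : Type u} [AddCommGroup V] [Module k V]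
    [FiniteDimensional k V] (hχ : D.χ ^ D.n = 1) (ρ : Representation k G V)
    (hρ : ρ (D.g ^ D.n) = 1) : (D.induced hχ ρ).Iso (D.stringModule ρ hρ le_rfl) := by
  have h : D.inducedAct hχ ρ = D.stringAct ρ hρ le_rfl := by
    refine algHom_ext ?_ fun h => ?_
    · rw [inducedAct_y, stringAct_y, hρ, sub_self, smul_zero]
      rfl
    · rw [inducedAct_gr, stringAct_gr]
  exact ⟨LinearEquiv.refl k _, fun a m => LinearMap.congr_fun (DFunLike.congr_fun h a) m⟩

theorem Omega₀.isProjective_M [CharZero k] [Finite G] (hχ : D.χ ^ D.n = 1) (i : D.Omega₀) :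
    (i.M le_rfl).IsProjective :=
  isProjective_of_isRetract hχ (isProjective_induced hχ i.ρ)
    (induced_iso_stringModule hχ i.ρ i.act_pow).symm.isRetract

theorem exists_iso_M [CharZero k] [Finite G] (hχ : D.χ ^ D.n = 1) {M : FDMod k D.H}
    (hM : M.IsProjective) (hM' : M.IsIndecomposable) (hγ : rep M.act (D.g ^ D.n) = 1) :
    ∃ i : D.Omega₀, M.Iso (i.M le_rfl) := by
  obtain ⟨U, hU⟩ := exists_iso_induced hχ hM hγ
  have hU' : U.toRepresentation (D.g ^ D.n) = 1 :=
    LinearMap.ext fun v => Subtype.ext (LinearMap.congr_fun hγ v.1)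
  exact ⟨⟨U.toSubmodule, U.toRepresentation, isIrreducible_of_isIndecomposable hχ _ hM' hU, hU'⟩,
    hU.trans (induced_iso_stringModule hχ _ hU')⟩

theorem fixedGreen_cls_M [Finite G] (i : D.Omega₀) :
    fixedGreen D (GreenRing.cls (i.M le_rfl)) = GreenRing.cls (i.Mbar le_rfl) := by
  rw [← i.restrict_cls_Mbar, fixedGreen_restrict]

/-- The fixed part of an indecomposable projective module is zero or some `M(n, i)`. -/
theorem fixedGreen_cls_of_isIndecomposable [CharZero k] [Finite G] (hχ : D.χ ^ D.n = 1)
    {M : FDMod k D.H} (hM : M.IsProjective) (hM' : M.IsIndecomposable) :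
    fixedGreen D (GreenRing.cls M) = 0 ∨ ∃ i : D.Omega₀, M.Iso (i.M le_rfl) := by
  rcases hM'.2 _ _ (iso_fixedSub_sum_movedSub M) with hs | hs
  · left
    rw [fixedGreen_cls]
    exact GreenRing.cls_eq_zero _ hs
  · right
    refine exists_iso_M hχ hM hM' ?_
    have h1 : movedSubmodule M = ⊥ := (Submodule.subsingleton_iff_eq_bot).1 hs
    exact sub_eq_zero.1 (LinearMap.range_eq_bot.1 h1)

end Structure

/-! ### Image and kernel of the homomorphism to `r(H)`. -/

section Kernel

variable [CharZero k] [Finite G]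

/-- For the class of a module, the fixed part supplies `b` and the projective moved part supplies
`c`. -/
theorem toRing_surjective (hχ : D.χ ^ D.n = 1) (hμ : D.μ ≠ 0) : Function.Surjective
    (TrivialExt.toRing (GreenRing.restrict D.proj) (GreenRing.projIdeal k D.H)) := by
  intro x
  suffices h : ∃ b, ∃ c ∈ GreenRing.projIdeal k D.H, GreenRing.restrict D.proj b + c = x by
    obtain ⟨b, c, hc, h⟩ := h
    exact ⟨⟨b, ⟨c, hc⟩⟩, h⟩
  induction x using GreenRing.induction with
  | zero => exact ⟨0, 0, zero_mem _, by simp⟩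
  | neg x hx =>
    obtain ⟨b, c, hc, rfl⟩ := hx
    exact ⟨-b, -c, neg_mem hc, by rw [map_neg]; abel⟩
  | add x y hx hy =>
    obtain ⟨b, c, hc, rfl⟩ := hx
    obtain ⟨b', c', hc', rfl⟩ := hy
    exact ⟨b + b', c + c', add_mem hc hc', by rw [map_add]; abel⟩
  | cls M =>
    refine ⟨_, _, ?_, (cls_eq_restrict_add M).symm⟩
    rw [← SetLike.mem_coe, coe_projIdeal hχ]
    exact cls_mem_closure_projIndec hχ (isProjective_movedSub hμ M)

/-- The required element depends additively on `c`, so `c` may be the class of an indecomposable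
projective. Its fixed part is then zero or the whole module, some `M(n, i)`, which gives `0` or a
generator. -/
theorem exists_mem_closure (hχ : D.χ ^ D.n = 1)
    (hP : ∀ i : D.Omega₀, GreenRing.cls (i.M le_rfl) ∈ GreenRing.projIdeal k D.H)
    {c : GreenRing k D.H} (hc : c ∈ AddSubgroup.closure (GreenRing.projIndec k D.H)) :
    ∃ s ∈ AddSubgroup.closure (Set.range fun i : D.Omega₀ =>
        (⟨-GreenRing.cls (i.Mbar le_rfl), ⟨GreenRing.cls (i.M le_rfl), hP i⟩⟩ :
          TrivialExt (GreenRing.restrict D.proj) (GreenRing.projIdeal k D.H))),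
      s.fst = -fixedGreen D c ∧
      (s.snd : GreenRing k D.H) = GreenRing.restrict D.proj (fixedGreen D c) := by
  induction hc using AddSubgroup.closure_induction with
  | zero => exact ⟨0, zero_mem _, by rw [map_zero, neg_zero]; rfl, by rw [map_zero, map_zero]; rfl⟩
  | add x y _ _ hx hy =>
    obtain ⟨s, hs, hs1, hs2⟩ := hx
    obtain ⟨t, ht, ht1, ht2⟩ := hy
    refine ⟨s + t, add_mem hs ht, ?_, ?_⟩
    · rw [TrivialExt.fst_add, hs1, ht1, map_add, neg_add]
    · rw [TrivialExt.snd_add, hs2, ht2, map_add, map_add]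
  | neg x _ hx =>
    obtain ⟨s, hs, hs1, hs2⟩ := hx
    refine ⟨-s, neg_mem hs, ?_, ?_⟩
    · rw [map_neg, ← hs1]
      rfl
    · rw [map_neg, map_neg, ← hs2]
      rfl
  | mem x hx =>
    obtain ⟨M, hM', hM, rfl⟩ := hx
    rcases fixedGreen_cls_of_isIndecomposable hχ hM hM' with h0 | ⟨i, hi⟩
    · rw [h0]
      exact ⟨0, zero_mem _, by rw [neg_zero]; rfl, by rw [map_zero]; rfl⟩
    · rw [GreenRing.cls_congr hi, fixedGreen_cls_M, i.restrict_cls_Mbar]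
      exact ⟨_, AddSubgroup.subset_closure ⟨i, rfl⟩, rfl, rfl⟩

/-- If `b + c = 0` in `r(H)`, then `fixedGreen` gives `b = -fixedGreen c`, and so `c = -b` is the
restriction of `fixedGreen c`. This identifies `(b, c)` with the element found in
`exists_mem_closure`. -/
theorem ker_toRing (hχ : D.χ ^ D.n = 1)
    (hP : ∀ i : D.Omega₀, GreenRing.cls (i.M le_rfl) ∈ GreenRing.projIdeal k D.H) :
    {x | TrivialExt.toRing (GreenRing.restrict D.proj) (GreenRing.projIdeal k D.H) x = 0} =
      (AddSubgroup.closure (Set.range fun i : D.Omega₀ =>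
        (⟨-GreenRing.cls (i.Mbar le_rfl), ⟨GreenRing.cls (i.M le_rfl), hP i⟩⟩ :
          TrivialExt (GreenRing.restrict D.proj) (GreenRing.projIdeal k D.H))) :
        Set (TrivialExt (GreenRing.restrict D.proj) (GreenRing.projIdeal k D.H))) := by
  refine Set.Subset.antisymm (fun x hx => ?_) (fun x hx => ?_)
  · rw [Set.mem_ofPred_eq, TrivialExt.toRing_apply] at hx
    have hc : (x.snd : GreenRing k D.H) ∈ AddSubgroup.closure (GreenRing.projIndec k D.H) := by
      rw [← SetLike.mem_coe, ← coe_projIdeal hχ]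
      exact x.snd.2
    obtain ⟨s, hs, hs1, hs2⟩ := exists_mem_closure hχ hP hc
    have h1 := congrArg (fixedGreen D) hx
    rw [map_add, fixedGreen_restrict, map_zero] at h1
    have h2 : fixedGreen D (x.snd : GreenRing k D.H) = -x.fst :=
      (neg_eq_of_add_eq_zero_right h1).symm
    rw [h2, neg_neg] at hs1
    rw [h2, map_neg, neg_eq_of_add_eq_zero_right hx] at hs2
    rwa [show x = s from TrivialExt.ext' hs1.symm hs2.symm]
  · have hle : AddSubgroup.closure (Set.range fun i : D.Omega₀ =>
        (⟨-GreenRing.cls (i.Mbar le_rfl), ⟨GreenRing.cls (i.M le_rfl), hP i⟩⟩ :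
          TrivialExt (GreenRing.restrict D.proj) (GreenRing.projIdeal k D.H))) ≤
        (TrivialExt.toRing (GreenRing.restrict D.proj)
          (GreenRing.projIdeal k D.H)).toAddMonoidHom.ker := by
      refine (AddSubgroup.closure_le _).2 ?_
      rintro _ ⟨i, rfl⟩
      change GreenRing.restrict D.proj (-GreenRing.cls (i.Mbar le_rfl)) +
        GreenRing.cls (i.M le_rfl) = 0
      rw [map_neg, i.restrict_cls_Mbar, neg_add_cancel]
    exact hle hx

end Kernel

end GroupDatum

theorem mainTheorem4 {k : Type u} [Field k] [IsAlgClosed k] [CharZero k]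
    {G : Type v} [Group G] [Finite G] (D : GroupDatum k G)
    (hD : D.NonNilpotent) (hn : 2 ≤ D.n) :
    -- the ideal `P` of `r(H)` is the `ℤ`-span of the indecomposable projectives
    (GreenRing.projIdeal k D.H : Set (GreenRing k D.H)) =
        AddSubgroup.closure (GreenRing.projIndec k D.H) ∧
    -- and contains the elements `M[n,i]`
    ∃ hP : ∀ i : D.Omega₀, GreenRing.cls (i.M le_rfl) ∈ GreenRing.projIdeal k D.H,
      -- the `ℤ`-span of the elements `(-M[n,i], M[n,i])` is an ideal of `r(H̄) ⊕ P`
      ∃ I : TwoSidedIdeal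
          (TrivialExt (GreenRing.restrict D.proj) (GreenRing.projIdeal k D.H)),
        (I : Set (TrivialExt (GreenRing.restrict D.proj) (GreenRing.projIdeal k D.H))) =
          AddSubgroup.closure (Set.range fun i : D.Omega₀ =>
            (⟨-GreenRing.cls (i.Mbar le_rfl), ⟨GreenRing.cls (i.M le_rfl), hP i⟩⟩ :
              TrivialExt (GreenRing.restrict D.proj) (GreenRing.projIdeal k D.H))) ∧
        -- and the quotient ring is isomorphic to `r(H)`
        Nonempty (I.ringCon.Quotient ≃+* GreenRing k D.H) := by
  have hχ := hD.2
  have hμ : D.μ ≠ 0 := by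
    intro h
    exact hD.1 (by rw [h, zero_smul])
  have hP : ∀ i : D.Omega₀, GreenRing.cls (i.M le_rfl) ∈ GreenRing.projIdeal k D.H := by
    intro i
    rw [← SetLike.mem_coe, GroupDatum.coe_projIdeal hχ]
    exact GroupDatum.cls_mem_closure_projIndec hχ (i.isProjective_M hχ)
  -- The ideal is taken to be the kernel, so it is two-sided from the start and the quotient is
  -- given by the first isomorphism theorem. What remains is that its elements form the stated span.
  refine ⟨GroupDatum.coe_projIdeal hχ, hP, TwoSidedIdeal.ofRingCon (RingCon.ker
    (TrivialExt.toRing (GreenRing.restrict D.proj) (GreenRing.projIdeal k D.H))), ?_,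
    ⟨RingCon.quotientKerEquivOfSurjective _ (GroupDatum.toRing_surjective hχ hμ)⟩⟩
  rw [← GroupDatum.ker_toRing hχ hP]
  ext x
  rw [SetLike.mem_coe, TwoSidedIdeal.mem_ofRingCon, RingCon.ker_apply, map_zero]
  rfl
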